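/- Let $\kappa$ be a regular uncountable cardinal and let $\mathcal I$ be a $\kappa$-complete proper ideal on $\kappa$ (the union of fewer than $\kappa$ members of $\mathcal I$ is in $\mathcal I$, and $\mathcal I\neq\mathscr P(\kappa)$) that contains every bounded subset of $\kappa$. For $\nu\in\{2,\kappa\}$ let $\tau_{\mathcal I}$ be the topology on ${}^{\kappa}\nu$ generated by the sets $\{x\in{}^{\kappa}\nu : f\subseteq x\}$, where $f\colon D\to\nu$ and $D\in\mathcal I$. Let $\mathcal I\text{-}\mathbf{Bor}({}^\kappa\nu)$ be the smallest family of subsets of ${}^\kappa\nu$ that contains the $\tau_{\mathcal I}$-open sets and is closed under complements and unions of at most $\kappa$ members. Let $\boldsymbol\Sigma^0_1$ be the class of $\tau_{\mathcal I}$-open sets and, for ordinals $\alpha>1$, let $\boldsymbol\Sigma^0_\alpha$ be the class of all unions $\bigcup_{\gamma<\kappa}A_\gamma$ such that each $A_\gamma$ is the complement of a set in $\boldsymbol\Sigma^0_\beta$ for some $1\le\beta<\alpha$. Then, for $\nu=2$ and for $\nu=\kappa$, the hierarchy does not collapse: there is no ordinal $1\le\alpha<\kappa^+$ with $\boldsymbol\Sigma^0_\alpha=\mathcal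 I\text{-}\mathbf{Bor}({}^\kappa\nu)$. Therefore it has length $\kappa^+$ on both spaces: $\kappa^+$ is the least ordinal $\alpha\ge 1$ with $\boldsymbol\Sigma^0_\alpha=\mathcal I\text{-}\mathbf{Bor}({}^\kappa\nu)$; for all $1\le\alpha<\beta<\kappa^+$ we have $\boldsymbol\Sigma^0_\beta\not\subseteq\boldsymbol\Sigma^0_\alpha$; and $\boldsymbol\Sigma^0_\alpha\subsetneq\boldsymbol\Sigma^0_\beta$ for all $1\le\alpha<\beta<\kappa^+$ with $(\alpha,\beta)\ne(1,2)$. (Hence $\boldsymbol\Sigma^0_1\subsetneq\boldsymbol\Sigma^0_2$ as well whenever $\boldsymbol\Sigma^0_1\subseteq\boldsymbol\Sigma^0_2$.) -/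

import Mathlib

open Cardinal Ordinal
open scoped Topology

universe u v

namespace IdealBorel

/-- An ideal `I` of subsets of `K` is `κ`-complete: the union of fewer than `κ` members
of `I` is a member of `I`. -/
def IsComplete {K : Type u} (κ : Cardinal.{u}) (I : Order.Ideal (Set K)) : Prop :=
  ∀ J : Set (Set K), (∀ D ∈ J, D ∈ I) → #J < κ → ⋃₀ J ∈ I

/-- `I` extends the ideal of bounded sets. -/
def ExtendsBounded {K : Type u} [LinearOrder K] (I : Order.Ideal (Set K)) : Prop :=
  ∀ D : Set K, BddAbove D → D ∈ I

/-- The cone of a partial function `f : D → ν`: all total functions that extend `f`. -/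
def cone {K : Type u} {ν : Type v} {D : Set K} (f : D → ν) : Set (K → ν) :=
  {x | ∀ i : D, x i = f i}

/-- The topology on `K → ν` generated by the cones of the partial functions
whose domain belongs to `I`. -/
@[reducible] def idealTopology {K : Type u} (I : Order.Ideal (Set K)) (ν : Type v) :
    TopologicalSpace (K → ν) :=
  TopologicalSpace.generateFrom {N | ∃ D ∈ I, ∃ f : D → ν, N = cone f}

/-- `IsSigma κ τ α A`: the set `A` belongs to the additive class `Σ⁰_α` of the `κ⁺`-Borel
hierarchy of the topology `τ`. The class `Σ⁰_1` consists of the open sets; for `α > 1`, the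
members of `Σ⁰_α` are the unions of `κ`-sequences of sets each of which is the complement
of a set in `Σ⁰_β` for some `1 ≤ β < α`. -/
inductive IsSigma (κ : Cardinal.{u}) {X : Type u} (τ : TopologicalSpace X) :
    Ordinal.{u} → Set X → Prop
  | of_isOpen (U : Set X) (hU : IsOpen[τ] U) : IsSigma κ τ 1 U
  | iUnion (α : Ordinal.{u}) (hα : 1 < α) (A : κ.ord.ToType → Set X)
      (β : κ.ord.ToType → Ordinal.{u}) (hβ : ∀ i, 1 ≤ β i) (hβα : ∀ i, β i < α)
      (hA : ∀ i, IsSigma κ τ (β i) (A i)ᶜ) : IsSigma κ τ α (⋃ i, A i)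

/-- The class `Σ⁰_α` of the `κ⁺`-Borel hierarchy of `τ` (meaningful for `α ≥ 1`;
it is empty for `α = 0`). -/
def sigmaClass (κ : Cardinal.{u}) {X : Type u} (τ : TopologicalSpace X) (α : Ordinal.{u}) :
    Set (Set X) :=
  {A | IsSigma κ τ α A}

/-- A `κ⁺`-algebra of subsets of `X`: closed under complements and under unions of
at most `κ` members. -/
structure IsSuccAlgebra (κ : Cardinal.{u}) {X : Type u} (𝒜 : Set (Set X)) : Prop where
  compl_mem : ∀ A ∈ 𝒜, Aᶜ ∈ 𝒜
  sUnion_mem : ∀ 𝒥 : Set (Set X), 𝒥 ⊆ 𝒜 → #𝒥 ≤ κ → ⋃₀ 𝒥 ∈ 𝒜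

/-- The `κ⁺`-Borel sets of `τ`: the smallest `κ⁺`-algebra that contains the open sets. -/
def borelClass (κ : Cardinal.{u}) {X : Type u} (τ : TopologicalSpace X) : Set (Set X) :=
  ⋂₀ {𝒜 | IsSuccAlgebra κ 𝒜 ∧ {U | IsOpen[τ] U} ⊆ 𝒜}

/-- The `κ⁺`-Borel hierarchy of `τ` collapses: some class `Σ⁰_α` with `1 ≤ α < κ⁺` already
contains exactly the `κ⁺`-Borel sets. -/
def Collapses (κ : Cardinal.{u}) {X : Type u} (τ : TopologicalSpace X) : Prop :=
  ∃ α : Ordinal.{u}, 1 ≤ α ∧ α < (Order.succ κ).ord ∧ sigmaClass κ τ α = borelClass κ τ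

/-- The `κ⁺`-Borel hierarchy of `τ` has length `κ⁺`. The first field says that `κ⁺` is the least
`α ≥ 1` with `Σ⁰_α` equal to the class of `κ⁺`-Borel sets. The other two say that the classes
`Σ⁰_α`, `1 ≤ α < κ⁺`, are strictly increasing, where only the inclusion of `Σ⁰_1` in `Σ⁰_2` is
not claimed (an open set need not be a union of `κ` many closed sets). -/
structure HasFullLength (κ : Cardinal.{u}) {X : Type u} (τ : TopologicalSpace X) : Prop where
  isLeast : IsLeast {α : Ordinal.{u} | 1 ≤ α ∧ sigmaClass κ τ α = borelClass κ τ}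
    (Order.succ κ).ord
  not_subset : ∀ α β : Ordinal.{u}, 1 ≤ α → α < β → β < (Order.succ κ).ord →
    ¬ sigmaClass κ τ β ⊆ sigmaClass κ τ α
  ssubset : ∀ α β : Ordinal.{u}, 1 ≤ α → α < β → β < (Order.succ κ).ord →
    ¬ (α = 1 ∧ β = 2) → sigmaClass κ τ α ⊂ sigmaClass κ τ β

end IdealBorel

namespace IdealBorel

/-! ### The Borel hierarchy and a diagonal criterion against collapse -/

section Hierarchy

variable {κ : Cardinal.{u}} {X : Type u} {τ : TopologicalSpace X} {α β : Ordinal.{u}} {A : Set X}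

/-! The core is a diagonal argument. For fixed `1 ≤ α < κ⁺`, one operation `Ev` produces every Σ⁰_α
set from a κ-sequence of open sets (`exists_universal_operation`). Hence it suffices to find Borel
sets `Z j` such that every κ-sequence `U` of open sets agrees with `Z` at some point
(`not_collapses_of_diagonal`): the complement of `Ev` applied to `Z` is Borel, and if it were `Ev`
applied to open sets `U`, a point of agreement would give a contradiction. The statements on the
length follow formally from noncollapse.

Sets `x ⊆ κ`, coded as supports of points, carry labelled and signed events, each determined by a
null part of `x`. Let `Z j` say that a last event of label `j` exists and is positive. Given `U`, a
point is built in κ stages (`EventSystem.exists_forall_mem_iff`). Stage `k` asks whether some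
admissible extension lies in `U k`, has no new events of labels below `k`, and has boundedly many
indices of events for each label. If so, a null part of such an extension is fixed that forces
membership. In either case an event of label `k` recording the answer is added beyond those present.
Later stages add no event of label `k`, so it remains the last one; the final point is itself among
the extensions that were considered, so a negative answer is correct too.

It remains to supply events. If some map into κ has only positive fibres, its value at `i` is the
event of `x` at `i ∈ x`. Otherwise the ideal is saturated, and on some positive set there is a least
function `g` unbounded modulo the ideal (`exists_isMinimalMod`); pressing down and stationary
reflection hold for it. Now an event occurs at a regular `i` below which `g '' x` is stationary, and
its label is read off from `g '' x` below `i` modulo bounded sets. Approximations have images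
avoiding a club and decide every point whose `g`-value is outside that club. This makes events
persist; diagonal unions give limits, and reflection gives new events
(`IsMinimalPair.nonempty_eventSystem`). -/

theorem IsSigma.one_le (h : IsSigma κ τ α A) : 1 ≤ α := by
  cases h with
  | of_isOpen U hU => exact le_rfl
  | iUnion α hα => exact hα.le

theorem isSigma_one_iff : IsSigma κ τ 1 A ↔ IsOpen[τ] A := by
  refine ⟨fun h => ?_, fun h => .of_isOpen A h⟩
  generalize hα : (1 : Ordinal.{u}) = α at h
  cases h with
  | of_isOpen U hU => exact hU
  | iUnion α h1 => exact absurd hα h1.ne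

theorem isSigma_iff (hα : 1 < α) :
    IsSigma κ τ α A ↔ ∃ B : κ.ord.ToType → Set X,
      (∀ i, ∃ β, 1 ≤ β ∧ β < α ∧ IsSigma κ τ β (B i)ᶜ) ∧ A = ⋃ i, B i := by
  constructor
  · intro h
    cases h with
    | of_isOpen U hU => exact absurd hα (lt_irrefl _)
    | iUnion α h1 B β h2 h3 h4 => exact ⟨B, fun i => ⟨β i, h2 i, h3 i, h4 i⟩, rfl⟩
  · rintro ⟨B, hB, rfl⟩
    choose β h1 h2 h3 using hB
    exact .iUnion α hα B β h1 h2 h3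

theorem isSuccAlgebra_borelClass : IsSuccAlgebra κ (borelClass κ τ) where
  compl_mem A hA 𝒜 h𝒜 := h𝒜.1.compl_mem A (hA 𝒜 h𝒜)
  sUnion_mem 𝒥 h𝒥 hc 𝒜 h𝒜 := h𝒜.1.sUnion_mem 𝒥 (fun _ hA => h𝒥 hA 𝒜 h𝒜) hc

theorem mem_borelClass_of_isOpen (h : IsOpen[τ] A) : A ∈ borelClass κ τ :=
  fun _ h𝒜 => h𝒜.2 h

theorem IsSuccAlgebra.iUnion_mem {𝒜 : Set (Set X)} (h : IsSuccAlgebra κ 𝒜) {ι : Type u}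
    (hι : #ι ≤ κ) {B : ι → Set X} (hB : ∀ i, B i ∈ 𝒜) : ⋃ i, B i ∈ 𝒜 := by
  rw [← Set.sUnion_range]
  exact h.sUnion_mem _ (Set.range_subset_iff.2 hB) (mk_range_le.trans hι)

theorem IsSuccAlgebra.iInter_mem {𝒜 : Set (Set X)} (h : IsSuccAlgebra κ 𝒜) {ι : Type u}
    (hι : #ι ≤ κ) {B : ι → Set X} (hB : ∀ i, B i ∈ 𝒜) : ⋂ i, B i ∈ 𝒜 := by
  rw [← compl_compl (⋂ i, B i), Set.compl_iInter]
  exact h.compl_mem _ (h.iUnion_mem hι fun i => h.compl_mem _ (hB i))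

theorem mk_index_le : #κ.ord.ToType ≤ κ := (mk_ord_toType κ).le

theorem IsSigma.mem_borelClass (h : IsSigma κ τ α A) : A ∈ borelClass κ τ := by
  induction h with
  | of_isOpen U hU => exact mem_borelClass_of_isOpen hU
  | iUnion α hα B β h1 h2 h3 ih =>
    refine isSuccAlgebra_borelClass.iUnion_mem mk_index_le fun i => ?_
    simpa using isSuccAlgebra_borelClass.compl_mem _ (ih i)

theorem nonempty_index (hκ : ℵ₀ ≤ κ) : Nonempty κ.ord.ToType := by
  rw [← mk_ne_zero_iff, mk_ord_toType]
  exact (aleph0_pos.trans_le hκ).ne'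

theorem IsSigma.compl (hκ : ℵ₀ ≤ κ) (h : IsSigma κ τ α A) (hαβ : α < β) :
    IsSigma κ τ β Aᶜ := by
  have := nonempty_index hκ
  refine (isSigma_iff (h.one_le.trans_lt hαβ)).2
    ⟨fun _ => Aᶜ, fun _ => ⟨α, h.one_le, hαβ, by simpa using h⟩, by rw [Set.iUnion_const]⟩

theorem IsSigma.mono_of_one_lt (h : IsSigma κ τ α A) (h1 : 1 < α) (hαβ : α ≤ β) :
    IsSigma κ τ β A := by
  obtain ⟨B, hB, rfl⟩ := (isSigma_iff h1).1 h
  refine (isSigma_iff (h1.trans_le hαβ)).2 ⟨B, fun i => ?_, rfl⟩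
  obtain ⟨γ, h1, h2, h3⟩ := hB i
  exact ⟨γ, h1, h2.trans_le hαβ, h3⟩

theorem IsSigma.mono (hκ : ℵ₀ ≤ κ) (h : IsSigma κ τ α A) (hαβ : α < β)
    (hne : ¬ (α = 1 ∧ β = 2)) : IsSigma κ τ β A := by
  rcases h.one_le.eq_or_lt with rfl | h1
  · have h2 : Order.succ (1 : Ordinal.{u}) = 2 := by
      rw [Order.succ_eq_add_one, one_add_one_eq_two]
    have h3 : (2 : Ordinal.{u}) < β :=
      lt_of_le_of_ne (h2 ▸ Order.succ_le_of_lt hαβ) fun h => hne ⟨rfl, h.symm⟩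
    -- Two complementations raise the rank from 1 through 2 to `β`; this is why the pair (1, 2) is
    -- excluded.
    simpa using (h.compl hκ (h2 ▸ Order.lt_succ 1 : (1 : Ordinal.{u}) < 2)).compl hκ h3
  · exact h.mono_of_one_lt h1 hαβ.le

/-- By regularity of `κ⁺`, the ranks of the κ many pieces are bounded below `κ⁺`, so the set already
has a smaller rank. -/
theorem IsSigma.compl_mem_succ (hκ : ℵ₀ ≤ κ) (h : IsSigma κ τ (Order.succ κ).ord A) :
    IsSigma κ τ (Order.succ κ).ord Aᶜ := by
  have hω : 1 < (Order.succ κ).ord := by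
    rw [lt_ord, card_one]
    exact one_lt_aleph0.trans_le (hκ.trans (Order.le_succ κ))
  obtain ⟨B, hB, rfl⟩ := (isSigma_iff hω).1 h
  choose γ h1 h2 h3 using hB
  have hr : (Order.succ κ).IsRegular := isRegular_succ hκ
  have hl : Order.IsSuccLimit (Order.succ κ).ord := isSuccLimit_ord (hκ.trans (Order.le_succ κ))
  have hb : (⨆ i, Order.succ (γ i)) < (Order.succ κ).ord := by
    refine Ordinal.iSup_lt_of_lt_cof ?_ fun i => hl.succ_lt (h2 i)
    rw [hr.cof_ord, mk_ord_toType]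
    exact Order.lt_succ κ
  have hle : ∀ i, γ i < ⨆ i, Order.succ (γ i) := fun i =>
    Order.succ_le_iff.1 (Ordinal.le_iSup (fun i => Order.succ (γ i)) i)
  have := nonempty_index hκ
  have h1' : 1 < ⨆ i, Order.succ (γ i) := (h1 (Classical.arbitrary _)).trans_lt (hle _)
  exact IsSigma.compl hκ ((isSigma_iff h1').2 ⟨B, fun i => ⟨γ i, h1 i, hle i, h3 i⟩, rfl⟩) hb

theorem isSigma_empty (hκ : ℵ₀ ≤ κ) (h : 1 ≤ α) : IsSigma κ τ α ∅ := by
  rcases h.eq_or_lt with rfl | h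
  · exact isSigma_one_iff.2 isOpen_empty
  · have := IsSigma.compl (τ := τ) hκ (isSigma_one_iff.2 isOpen_univ) h
    rwa [Set.compl_univ] at this

theorem exists_iUnion_eq_sUnion (hκ : ℵ₀ ≤ κ) (𝒥 : Set (Set X)) (h : #𝒥 ≤ κ) :
    ∃ B : κ.ord.ToType → Set X, (∀ i, B i ∈ 𝒥 ∨ B i = ∅) ∧ ⋃₀ 𝒥 = ⋃ i, B i := by
  have := nonempty_index hκ
  rcases isEmpty_or_nonempty 𝒥 with h0 | h0
  · refine ⟨fun _ => ∅, fun _ => Or.inr rfl, ?_⟩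
    rw [Set.isEmpty_coe_sort.1 h0]
    simp
  · rw [← mk_ord_toType κ] at h
    obtain ⟨f, hf⟩ : ∃ f : κ.ord.ToType → 𝒥, Function.Surjective f := by
      obtain ⟨g⟩ := h
      exact ⟨Function.invFun g, Function.invFun_surjective g.injective⟩
    refine ⟨fun i => f i, fun i => Or.inl (f i).2, ?_⟩
    rw [Set.sUnion_eq_iUnion]
    exact (hf.iUnion_comp fun A : 𝒥 => (A : Set X)).symm

theorem IsSigma.sUnion (hκ : ℵ₀ ≤ κ) (h1 : 1 ≤ α) (𝒥 : Set (Set X)) (h𝒥 : 𝒥 ⊆ sigmaClass κ τ α)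
    (hc : #𝒥 ≤ κ) : IsSigma κ τ α (⋃₀ 𝒥) := by
  rcases h1.eq_or_lt with rfl | h1
  · exact isSigma_one_iff.2 (isOpen_sUnion fun A hA => isSigma_one_iff.1 (h𝒥 hA))
  obtain ⟨B, hB, h⟩ := exists_iUnion_eq_sUnion hκ 𝒥 hc
  have hB' : ∀ i, IsSigma κ τ α (B i) := fun i => by
    rcases hB i with h | h
    · exact h𝒥 h
    · rw [h]
      exact isSigma_empty hκ h1.le
  choose C hC hBC using fun i => (isSigma_iff h1).1 (hB' i)
  have hK : #(κ.ord.ToType × κ.ord.ToType) = #κ.ord.ToType := by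
    rw [mk_prod, Cardinal.lift_id, mk_ord_toType, mul_eq_self hκ]
  obtain ⟨e⟩ := Cardinal.eq.1 hK
  rw [h, isSigma_iff h1]
  refine ⟨fun i => C (e.symm i).1 (e.symm i).2, fun i => hC _ _, ?_⟩
  rw [e.symm.surjective.iUnion_comp fun p : κ.ord.ToType × κ.ord.ToType => C p.1 p.2,
    Set.iUnion_prod']
  exact Set.iUnion_congr hBC

theorem sigmaClass_succ_eq_borelClass (hκ : ℵ₀ ≤ κ) :
    sigmaClass κ τ (Order.succ κ).ord = borelClass κ τ := by
  refine Set.Subset.antisymm (fun A hA => IsSigma.mem_borelClass hA) fun A hA => ?_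
  have h3 : ((3 : ℕ) : Ordinal.{u}) < (Order.succ κ).ord := by
    rw [lt_ord, card_nat]
    exact (natCast_lt_aleph0).trans_le (hκ.trans (Order.le_succ κ))
  have h12 : (1 : Ordinal.{u}) < (Order.succ κ).ord := lt_of_le_of_lt (by norm_num) h3
  have h2 : (2 : Ordinal.{u}) < (Order.succ κ).ord := lt_of_le_of_lt (by norm_num) h3
  refine hA _ ⟨⟨fun A hA => IsSigma.compl_mem_succ hκ hA, fun 𝒥 h𝒥 hc => ?_⟩, fun U hU => ?_⟩
  · exact IsSigma.sUnion hκ h12.le 𝒥 h𝒥 hc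
  · exact (isSigma_one_iff.2 hU).mono hκ h12 fun h => h2.ne' h.2

/-- Complements of Σ⁰_α sets lie in Σ⁰_β, so the inclusion makes Σ⁰_α a `κ⁺`-algebra containing the
open sets. -/
theorem eq_borelClass_of_subset (hκ : ℵ₀ ≤ κ) (h1 : 1 ≤ α) (hαβ : α < β)
    (h : sigmaClass κ τ β ⊆ sigmaClass κ τ α) : sigmaClass κ τ α = borelClass κ τ := by
  have hc : ∀ A, IsSigma κ τ α A → IsSigma κ τ α Aᶜ := fun A hA => h (hA.compl hκ hαβ)
  refine Set.Subset.antisymm (fun A hA => IsSigma.mem_borelClass hA) fun A hA => ?_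
  refine hA _ ⟨⟨hc, IsSigma.sUnion hκ h1⟩, fun U hU => ?_⟩
  have := hc _ (h ((isSigma_one_iff.2 hU).compl hκ (h1.trans_lt hαβ)))
  rwa [compl_compl] at this

theorem hasFullLength_of_not_collapses (hκ : ℵ₀ ≤ κ) (h : ¬ Collapses κ τ) :
    HasFullLength κ τ := by
  have hns : ∀ α β : Ordinal.{u}, 1 ≤ α → α < β → β < (Order.succ κ).ord →
      ¬ sigmaClass κ τ β ⊆ sigmaClass κ τ α := fun α β h1 h2 h3 h4 =>
    h ⟨α, h1, h2.trans h3, eq_borelClass_of_subset hκ h1 h2 h4⟩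
  refine ⟨⟨⟨?_, sigmaClass_succ_eq_borelClass hκ⟩, fun α hα => ?_⟩, hns, fun α β h1 h2 h3 h4 =>
    ⟨fun A hA => IsSigma.mono hκ hA h2 h4, hns α β h1 h2 h3⟩⟩
  · rw [Order.one_le_iff_pos, lt_ord, card_zero]
    exact aleph0_pos.trans_le (hκ.trans (Order.le_succ κ))
  · by_contra hlt
    exact h ⟨α, hα.1, not_le.1 hlt, hα.2⟩

/-- Every set of class `Σ⁰_α` is obtained from a `κ`-sequence of open sets by one fixed
Boolean operation that preserves `κ⁺`-Borel sets. -/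
theorem exists_universal_operation (hκ : ℵ₀ ≤ κ) (α : Ordinal.{u}) (h1 : 1 ≤ α)
    (hα : α < (Order.succ κ).ord) : ∃ Ev : (κ.ord.ToType → Prop) → Prop,
      (∀ A, IsSigma κ τ α A → ∃ U : κ.ord.ToType → Set X, (∀ j, IsOpen[τ] (U j)) ∧
        A = {x | Ev fun j => x ∈ U j}) ∧
      ∀ Z : κ.ord.ToType → Set X, (∀ j, Z j ∈ borelClass κ τ) →
        {x | Ev fun j => x ∈ Z j} ∈ borelClass κ τ := by
  induction α using WellFoundedLT.induction with
  | ind α ih =>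
  have hne := nonempty_index hκ
  rcases h1.eq_or_lt with rfl | h1
  · refine ⟨fun p => ∃ j, p j, fun A hA => ⟨fun _ => A, fun _ => isSigma_one_iff.1 hA, ?_⟩,
      fun Z hZ => ?_⟩
    · ext x
      simp
    · simpa [Set.ext_iff, Set.ofPred_exists] using
        isSuccAlgebra_borelClass.iUnion_mem mk_index_le hZ
  have hcard : #α.ToType ≤ #κ.ord.ToType := by
    rw [mk_toType, mk_ord_toType, ← Order.lt_succ_iff, ← lt_ord]
    exact hα
  have hone : Nonempty {β // 1 ≤ β ∧ β < α} := ⟨⟨1, le_rfl, h1⟩⟩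
  obtain ⟨b, hb⟩ : ∃ b : κ.ord.ToType → {β // 1 ≤ β ∧ β < α}, Function.Surjective b := by
    obtain ⟨g⟩ := hcard
    let f : {β // 1 ≤ β ∧ β < α} → κ.ord.ToType := fun β =>
      g (Ordinal.ToType.mk ⟨β.1, β.2.2⟩)
    have hf : Function.Injective f := fun β γ h => by
      have := Ordinal.ToType.mk.injective (g.injective h)
      exact Subtype.ext (Subtype.mk.inj this)
    exact ⟨Function.invFun f, Function.invFun_surjective hf⟩
  choose Ev hEv hEvB using fun β : {β // 1 ≤ β ∧ β < α} => ih β.1 β.2.2 β.2.1 (β.2.2.trans hα)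
  have hK : #(κ.ord.ToType × κ.ord.ToType × κ.ord.ToType) = #κ.ord.ToType := by
    simp only [mk_prod, Cardinal.lift_id, mk_ord_toType, mul_eq_self hκ]
  obtain ⟨e⟩ := Cardinal.eq.1 hK
  refine ⟨fun p => ∃ m n, ¬ Ev (b m) fun j => p (e (m, n, j)), fun A hA => ?_, fun Z hZ => ?_⟩
  · obtain ⟨B, hB, rfl⟩ := (isSigma_iff h1).1 hA
    choose γ hγ1 hγ2 hγ using hB
    -- `m` guesses the rank of the `n`-th piece. Wrong guesses are filled with `Set.univ`, whose
    -- complement adds nothing to the union.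
    have hC : ∀ m n, ∃ V : κ.ord.ToType → Set X, (∀ j, IsOpen[τ] (V j)) ∧
        (if (b m).1 = γ n then (B n)ᶜ else Set.univ) = {x | Ev (b m) fun j => x ∈ V j} := by
      intro m n
      refine hEv (b m) _ ?_
      split_ifs with h
      · rw [h]
        exact hγ n
      · rcases (b m).2.1.eq_or_lt with h | h
        · rw [← h]
          exact isSigma_one_iff.2 isOpen_univ
        · rw [← Set.compl_empty]
          exact IsSigma.compl hκ (isSigma_one_iff.2 isOpen_empty) h
    choose V hV hVe using hC
    refine ⟨fun i => V (e.symm i).1 (e.symm i).2.1 (e.symm i).2.2, fun i => hV _ _ _, ?_⟩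
    ext x
    have hx : ∀ m n, (Ev (b m) fun j => x ∈ V m n j) ↔ ((b m).1 = γ n → x ∉ B n) := by
      intro m n
      have : x ∈ {x | Ev (b m) fun j => x ∈ V m n j} ↔ ((b m).1 = γ n → x ∉ B n) := by
        rw [← hVe]
        split_ifs with h <;> simp [h]
      exact this
    simp only [Set.mem_iUnion, Set.mem_ofPred_eq, Equiv.symm_apply_apply, hx]
    push Not
    constructor
    · rintro ⟨n, hn⟩
      obtain ⟨m, hm⟩ := hb ⟨γ n, hγ1 n, hγ2 n⟩
      exact ⟨m, n, by rw [hm], hn⟩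
    · rintro ⟨m, n, -, hn⟩
      exact ⟨n, hn⟩
  · have := (isSuccAlgebra_borelClass (τ := τ) (κ := κ)).iUnion_mem mk_index_le fun m =>
      isSuccAlgebra_borelClass.iUnion_mem mk_index_le fun n =>
        isSuccAlgebra_borelClass.compl_mem _ (hEvB (b m) (fun j => Z (e (m, n, j))) fun j => hZ _)
    convert this using 1
    ext x
    simp

/-- The hierarchy of `τ` does not collapse if there is a `κ`-sequence of Borel sets that
agrees with every `κ`-sequence of open sets at some point. -/
theorem not_collapses_of_diagonal (hκ : ℵ₀ ≤ κ) (Z : κ.ord.ToType → Set X)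
    (hZ : ∀ j, Z j ∈ borelClass κ τ)
    (h : ∀ U : κ.ord.ToType → Set X, (∀ j, IsOpen[τ] (U j)) → ∃ x, ∀ j, x ∈ U j ↔ x ∈ Z j) :
    ¬ Collapses κ τ := by
  rintro ⟨α, h1, hα, he⟩
  obtain ⟨Ev, hEv, hB⟩ := exists_universal_operation (τ := τ) hκ α h1 hα
  have hmem : {x | Ev fun j => x ∈ Z j}ᶜ ∈ sigmaClass κ τ α := by
    rw [he]
    exact isSuccAlgebra_borelClass.compl_mem _ (hB Z hZ)
  obtain ⟨U, hU, hUe⟩ := hEv _ hmem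
  obtain ⟨x, hx⟩ := h U hU
  have := Set.ext_iff.1 hUe x
  simp only [Set.mem_compl_iff, Set.mem_ofPred_eq, hx] at this
  tauto

end Hierarchy

/-! ### Recursive choice and null families -/

/-- A sequence along a well-order can be built by recursion on a relation that depends only on
the earlier terms. -/
theorem exists_seq_of_rel {K : Type u} [LinearOrder K] [WellFoundedLT K] {T : Type v} [Inhabited T]
    (R : K → (K → T) → T → Prop)
    (hR : ∀ k s s' t, (∀ l < k, s l = s' l) → R k s t → R k s' t)
    (hex : ∀ k s, (∀ l < k, R l s (s l)) → ∃ t, R k s t) : ∃ s : K → T, ∀ k, R k s (s k) := by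
  classical
  let F : (k : K) → ((l : K) → l < k → T) → T := fun k prev =>
    Classical.epsilon (R k fun l => if h : l < k then prev l h else default)
  let s : K → T := (wellFounded_lt (α := K)).fix F
  have hs : ∀ k, s k = Classical.epsilon (R k fun l => if l < k then s l else default) := by
    intro k
    have := (wellFounded_lt (α := K)).fix_eq F k
    simpa [F, s] using this
  refine ⟨s, fun k => ?_⟩
  induction k using WellFoundedLT.induction with
  | ind k ih =>
    have hag : ∀ l < k, s l = if l < k then s l else default := fun l hl => by rw [if_pos hl]
    obtain ⟨t, ht⟩ := hex k s ih
    have := Classical.epsilon_spec (p := R k fun l => if l < k then s l else default)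
      ⟨t, hR _ _ _ _ hag ht⟩
    rw [← hs k] at this
    exact hR _ _ _ _ (fun l hl => (hag l hl).symm) this

/-- A well-order of regular uncountable order type. -/
class RegularIndex (K : Type u) [LinearOrder K] : Prop where
  aleph0_lt : ℵ₀ < #K
  mk_Iic_lt : ∀ k : K, #(Set.Iic k) < #K
  exists_lt : ∀ {ι : Type u}, #ι < #K → ∀ f : ι → K, ∃ b, ∀ i, f i < b

/-- The closure properties of a proper complete ideal that contains the bounded sets. -/
structure IsNullFamily {K : Type u} [LinearOrder K] (N : Set (Set K)) : Prop where
  mono : ∀ {D D' : Set K}, D ∈ N → D' ⊆ D → D' ∈ N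
  iUnion_mem : ∀ {ι : Type u}, #ι < #K → ∀ {D : ι → Set K}, (∀ i, D i ∈ N) → ⋃ i, D i ∈ N
  univ_notMem : Set.univ ∉ N
  Iic_mem : ∀ k : K, Set.Iic k ∈ N

section

variable {K : Type u} [LinearOrder K]

theorem RegularIndex.mk_Iio_lt [RegularIndex K] (k : K) : #(Set.Iio k) < #K :=
  (mk_le_mk_of_subset Set.Iio_subset_Iic_self).trans_lt (mk_Iic_lt k)

theorem RegularIndex.exists_lt_Iic [RegularIndex K] (k : K) (f : K → K) :
    ∃ b, ∀ l ≤ k, f l < b := by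
  obtain ⟨b, hb⟩ := exists_lt (mk_Iic_lt k) fun l => f l
  exact ⟨b, fun l hl => hb ⟨l, hl⟩⟩

theorem RegularIndex.mk_lt_of_countable [RegularIndex K] {ι : Type u} [Countable ι] :
    #ι < #K :=
  (mk_le_aleph0 (α := ι)).trans_lt aleph0_lt

theorem RegularIndex.exists_gt [RegularIndex K] (k : K) : ∃ b, k < b := by
  obtain ⟨b, hb⟩ := exists_lt_Iic k id
  exact ⟨b, hb k le_rfl⟩

variable {N : Set (Set K)}

theorem IsNullFamily.biUnion_Iic_mem [RegularIndex K] (hN : IsNullFamily N) (k : K)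
    {D : K → Set K} (hD : ∀ l ≤ k, D l ∈ N) : ⋃ l ≤ k, D l ∈ N := by
  refine hN.mono (hN.iUnion_mem (RegularIndex.mk_Iic_lt k) (D := fun l => D l) fun l => hD l l.2)
    fun x => ?_
  simp

theorem IsNullFamily.biUnion_Iio_mem [RegularIndex K] (hN : IsNullFamily N) (k : K)
    {D : K → Set K} (hD : ∀ l < k, D l ∈ N) : ⋃ l < k, D l ∈ N := by
  refine hN.mono (hN.iUnion_mem (RegularIndex.mk_Iio_lt k) (D := fun l => D l) fun l => hD l l.2)
    fun x => ?_
  simp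

theorem IsNullFamily.union_mem [RegularIndex K] (hN : IsNullFamily N) {D D' : Set K}
    (h : D ∈ N) (h' : D' ∈ N) : D ∪ D' ∈ N := by
  have := hN.iUnion_mem (ι := ULift Bool) (RegularIndex.mk_lt_of_countable)
    (D := fun b => cond b.down D D') (by rintro ⟨_ | _⟩ <;> assumption)
  refine hN.mono this (Set.union_subset (fun x hx => ?_) fun x hx => ?_)
  · exact Set.mem_iUnion.2 ⟨⟨true⟩, hx⟩
  · exact Set.mem_iUnion.2 ⟨⟨false⟩, hx⟩

theorem IsNullFamily.empty_mem [RegularIndex K] (hN : IsNullFamily N) : ∅ ∈ N := by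
  obtain ⟨k⟩ := mk_ne_zero_iff.1 (aleph0_pos.trans (RegularIndex.aleph0_lt (K := K))).ne'
  exact hN.mono (hN.Iic_mem k) (Set.empty_subset _)

/-! ### Event systems and the construction of a deciding point -/

/-- A set is open if membership of each of its points is decided by a null trace. -/
def IsTraceOpen (N : Set (Set K)) (U : Set (Set K)) : Prop :=
  ∀ x ∈ U, ∃ E ∈ N, ∀ y, y ∩ E = x ∩ E → y ∈ U

/-- An increasing sequence of pairs `(a l, D l)`, each end-extending the earlier ones. -/
structure IsApproxChain (valid : Set K → Set K → Prop) (front : K → Set K) (J : Set K)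
    (a D : K → Set K) : Prop where
  valid : ∀ l ∈ J, valid (a l) (D l)
  inter_eq : ∀ l ∈ J, ∀ m < l, a l ∩ D m = a m
  subset : ∀ l ∈ J, ∀ m < l, D m ⊆ D l
  front_subset : ∀ l ∈ J, a l ∩ front l ⊆ ⋃ m < l, a m

variable (N) in
/-- A way of reading off, from a set `x`, a sequence of labelled events, such that
approximations can be extended by single events of arbitrary label. -/
structure EventSystem where
  /-- the event, if any, that occurs at an index -/
  ev : Set K → K → Option (K × Bool)
  /-- the approximations -/
  valid : Set K → Set K → Prop
  /-- the sets all of whose traces can be extended to approximations -/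
  admissible : Set K → Prop
  /-- the part that stage `k` of an increasing sequence has to leave unchanged -/
  front : K → Set K
  ev_local : ∀ i, ∃ B ∈ N, ∀ x y, x ∩ B = y ∩ B → ev x i = ev y i
  valid_mem : ∀ {a D}, valid a D → D ∈ N
  valid_subset : ∀ {a D}, valid a D → a ⊆ D
  valid_mono : ∀ {a D D'}, valid a D → D ⊆ D' → D' ∈ N → valid a D'
  front_mem : ∀ k, front k ∈ N
  persist : ∀ {a D x i v}, valid a D → x ∩ D = a → ev a i = some v → ev x i = some v
  restrict : ∀ {x D}, admissible x → D ∈ N → ∃ D', D ⊆ D' ∧ valid (x ∩ D') D' ∧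
    ∀ i v, ev (x ∩ D') i = some v → ev x i = some v
  limit_ev : ∀ {J a D i v}, IsLowerSet J → IsApproxChain valid front J a D →
    ev (⋃ l ∈ J, a l) i = some v → ∃ l ∈ J, ev (a l) i = some v
  limit_admissible : ∀ {J a D}, IsLowerSet J → IsApproxChain valid front J a D →
    admissible (⋃ l ∈ J, a l)
  limit_valid : ∀ {k a D}, IsApproxChain valid front (Set.Iio k) a D →
    ∃ D', (∀ l < k, D l ⊆ D') ∧ valid (⋃ l < k, a l) D'
  add : ∀ {a D}, valid a D → ∀ k j ε, ∃ a' D' i, valid a' D' ∧ D ⊆ D' ∧ a' ∩ D = a ∧ k < i ∧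
    ev a' i = some (j, ε) ∧ ∀ i' ≠ i, ev a' i' = ev a i'

theorem IsApproxChain.biUnion_inter {valid : Set K → Set K → Prop} {front : K → Set K} {J : Set K}
    {a D : K → Set K} (h : IsApproxChain valid front J a D) (hsub : ∀ {a D}, valid a D → a ⊆ D)
    {l : K} (hl : l ∈ J) : (⋃ m ∈ J, a m) ∩ D l = a l := by
  ext x
  simp only [Set.mem_inter_iff, Set.mem_iUnion]
  constructor
  · rintro ⟨⟨m, hm, hx⟩, hxl⟩
    rcases lt_trichotomy m l with hml | rfl | hml
    · exact (h.inter_eq l hl m hml ▸ hx : x ∈ a l ∩ D m).1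
    · exact hx
    · exact h.inter_eq m hm l hml ▸ ⟨hx, hxl⟩
  · exact fun hx => ⟨⟨l, hl, hx⟩, hsub (h.valid l hl) hx⟩

theorem IsApproxChain.mono {valid : Set K → Set K → Prop} {front : K → Set K} {J J' : Set K}
    {a D : K → Set K} (h : IsApproxChain valid front J a D) (hJ : J' ⊆ J) :
    IsApproxChain valid front J' a D :=
  ⟨fun l hl => h.valid l (hJ hl), fun l hl => h.inter_eq l (hJ hl), fun l hl => h.subset l (hJ hl),
    fun l hl => h.front_subset l (hJ hl)⟩

theorem IsApproxChain.front_mono {valid : Set K → Set K → Prop}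
    {front front' : K → Set K} {J : Set K} {a D : K → Set K}
    (h : IsApproxChain valid front' J a D) (hf : ∀ k, front k ⊆ front' k) :
    IsApproxChain valid front J a D :=
  ⟨h.valid, h.inter_eq, h.subset, fun l hl =>
    (Set.inter_subset_inter_right _ (hf l)).trans (h.front_subset l hl)⟩

namespace EventSystem

variable (𝓔 : EventSystem N)

/-- The events of each label are bounded. -/
def Bounded (x : Set K) : Prop :=
  ∀ j, ∃ b, ∀ i ε, 𝓔.ev x i = some (j, ε) → i ≤ b

/-- The events of `x` of label below `k` are events of `y`. -/
def Promise (k : K) (y x : Set K) : Prop :=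
  ∀ j < k, ∀ i ε, 𝓔.ev x i = some (j, ε) → 𝓔.ev y i = some (j, ε)

/-- The last event of label `j` exists and has value `ε`. -/
def LastEvent (x : Set K) (j : K) (ε : Bool) : Prop :=
  ∃ i, 𝓔.ev x i = some (j, ε) ∧ ∀ i' > i, ∀ ε', 𝓔.ev x i' ≠ some (j, ε')

variable {𝓔}

theorem LastEvent.unique {x : Set K} {j : K} {ε ε' : Bool} (h : 𝓔.LastEvent x j ε)
    (h' : 𝓔.LastEvent x j ε') : ε = ε' := by
  obtain ⟨i, hi, h⟩ := h
  obtain ⟨i', hi', h'⟩ := h'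
  rcases lt_trichotomy i i' with hlt | rfl | hlt
  · exact absurd hi' (h i' hlt ε')
  · simpa [hi] using hi'
  · exact absurd hi (h' i hlt ε)

/-- The requirement on stage `k` of the construction of a point that decides all the sets `U k`. -/
structure Stage (𝓔 : EventSystem N) (U : K → Set (Set K)) (k : K) (s : K → Set K × Set K)
    (t : Set K × Set K) : Prop where
  valid : 𝓔.valid t.1 t.2
  inter_eq : ∀ l < k, t.1 ∩ (s l).2 = (s l).1
  subset : ∀ l < k, (s l).2 ⊆ t.2
  front_subset : t.1 ∩ 𝓔.front k ⊆ ⋃ l < k, (s l).1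
  bounded : 𝓔.Bounded t.1
  promise : 𝓔.Promise k (⋃ l < k, (s l).1) t.1
  decide : ∃ ε, 𝓔.LastEvent t.1 k ε ∧
    (ε = true → ∀ x, x ∩ t.2 = t.1 → x ∈ U k) ∧
    (ε = false → ∀ x, 𝓔.admissible x → x ∩ t.2 = t.1 → 𝓔.Promise k (⋃ l < k, (s l).1) x →
      𝓔.Bounded x → x ∉ U k)

theorem Stage.isChain {U : K → Set (Set K)} {J : Set K} {s : K → Set K × Set K}
    (h : ∀ l ∈ J, 𝓔.Stage U l s (s l)) :
    IsApproxChain 𝓔.valid 𝓔.front J (fun l => (s l).1) fun l => (s l).2 :=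
  ⟨fun l hl => (h l hl).valid, fun l hl => (h l hl).inter_eq, fun l hl => (h l hl).subset,
    fun l hl => (h l hl).front_subset⟩

/-- An event of label `j` found at a stage `l > j` is, by the promise at `l`, an event of the
preceding union, hence of an earlier stage; descend until the stage is at most `j`. -/
theorem Stage.event_early [WellFoundedLT K] {U : K → Set (Set K)} {J : Set K} (hJ : IsLowerSet J)
    {s : K → Set K × Set K} (h : ∀ l ∈ J, 𝓔.Stage U l s (s l)) {i j : K} {ε : Bool}
    (he : 𝓔.ev (⋃ l ∈ J, (s l).1) i = some (j, ε)) :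
    ∃ m ∈ J, m ≤ j ∧ 𝓔.ev (s m).1 i = some (j, ε) := by
  obtain ⟨l, hl, hel⟩ := 𝓔.limit_ev hJ (Stage.isChain h) he
  clear he
  induction l using WellFoundedLT.induction with
  | ind l ih =>
    rcases le_or_gt l j with hlj | hlj
    · exact ⟨l, hl, hlj, hel⟩
    · have := (h l hl).promise j hlj i ε hel
      obtain ⟨m, hm, hem⟩ := 𝓔.limit_ev (J := Set.Iio l) (isLowerSet_Iio l)
        (Stage.isChain (U := U) (s := s) fun m hm => h m (hJ (le_of_lt hm) hl)) this
      exact ih m hm (hJ (le_of_lt hm) hl) hem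

/-- Events of label `j` come from stages up to `j`, and regularity bounds these fewer than κ bounds
together. -/
theorem Stage.bounded_biUnion [RegularIndex K] [WellFoundedLT K] {U : K → Set (Set K)} {J : Set K}
    (hJ : IsLowerSet J) {s : K → Set K × Set K} (h : ∀ l ∈ J, 𝓔.Stage U l s (s l)) :
    𝓔.Bounded (⋃ l ∈ J, (s l).1) := by
  intro j
  have hb : ∀ m : K, ∃ b, m ∈ J → ∀ i ε, 𝓔.ev (s m).1 i = some (j, ε) → i ≤ b := by
    intro m
    by_cases hm : m ∈ J
    · obtain ⟨b, hb⟩ := (h m hm).bounded j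
      exact ⟨b, fun _ => hb⟩
    · exact ⟨j, fun h => absurd h hm⟩
  choose f hf using hb
  obtain ⟨b, hb⟩ := RegularIndex.exists_lt_Iic j f
  refine ⟨b, fun i ε he => ?_⟩
  obtain ⟨m, hm, hmj, hem⟩ := Stage.event_early hJ h he
  exact (hf m hm i ε hem).trans (hb m hmj).le

theorem Stage.congr {U : K → Set (Set K)} {k : K} {s s' : K → Set K × Set K} {t : Set K × Set K}
    (hs : ∀ l < k, s l = s' l) (h : 𝓔.Stage U k s t) : 𝓔.Stage U k s' t := by
  have hu : (⋃ l < k, (s l).1) = ⋃ l < k, (s' l).1 :=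
    Set.iUnion₂_congr fun l hl => by rw [hs l hl]
  obtain ⟨h1, h2, h3, h4, h5, h6, h7⟩ := h
  rw [hu] at h4 h6 h7
  exact ⟨h1, fun l hl => hs l hl ▸ h2 l hl, fun l hl => hs l hl ▸ h3 l hl, h4, h5, h6, h7⟩

theorem exists_stage [RegularIndex K] [WellFoundedLT K] (hN : IsNullFamily N)
    {U : K → Set (Set K)} (hU : ∀ k, IsTraceOpen N (U k)) (k : K) (s : K → Set K × Set K)
    (h : ∀ l < k, 𝓔.Stage U l s (s l)) : ∃ t, 𝓔.Stage U k s t := by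
  have hch := Stage.isChain (J := Set.Iio k) h
  have hbd := Stage.bounded_biUnion (isLowerSet_Iio k) h
  obtain ⟨D₀, hD₀, hv₀⟩ := 𝓔.limit_valid hch
  have hint : ∀ l < k, (⋃ l < k, (s l).1) ∩ (s l).2 = (s l).1 := fun l hl =>
    hch.biUnion_inter 𝓔.valid_subset (l := l) hl
  have hbd : 𝓔.Bounded (⋃ l < k, (s l).1) := hbd
  clear hch
  set A := ⋃ l < k, (s l).1 with hA
  have hD₁ : D₀ ∪ 𝓔.front k ∈ N := hN.union_mem (𝓔.valid_mem hv₀) (𝓔.front_mem k)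
  have hv₁ := 𝓔.valid_mono hv₀ Set.subset_union_left hD₁
  set D₁ := D₀ ∪ 𝓔.front k with hD₁e
  -- it suffices to prepare an approximation that can be extended by a last event of label `k`
  suffices H : ∃ a₂ D₂ ε, 𝓔.valid a₂ D₂ ∧ D₁ ⊆ D₂ ∧ a₂ ∩ D₁ = A ∧ 𝓔.Bounded a₂ ∧
      𝓔.Promise k A a₂ ∧ (ε = true → ∀ x, x ∩ D₂ = a₂ → x ∈ U k) ∧
      (ε = false → ∀ x, 𝓔.admissible x → x ∩ D₂ = a₂ → 𝓔.Promise k A x →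
        𝓔.Bounded x → x ∉ U k) by
    obtain ⟨a₂, D₂, ε, hv₂, hD₂, ha₂, hb₂, hp₂, ht, hf⟩ := H
    obtain ⟨b, hb⟩ := hb₂ k
    obtain ⟨a', D', i, hv', hD', ha', hbi, hev, hne⟩ := 𝓔.add hv₂ b k ε
    have hsub : ∀ x E, E ⊆ D₂ → x ∩ D' = a' → x ∩ E = a₂ ∩ E := by
      intro x E hE hx
      rw [← ha', ← hx]
      ext y
      simp only [Set.mem_inter_iff]
      exact ⟨fun h => ⟨⟨⟨h.1, hD' (hE h.2)⟩, hE h.2⟩, h.2⟩, fun h => ⟨h.1.1.1, h.2⟩⟩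
    have haE : ∀ E, E ⊆ D₁ → a' ∩ E = A ∩ E := by
      intro E hE
      rw [hsub a' E (hE.trans hD₂) (Set.inter_eq_left.2 (𝓔.valid_subset hv')), ← ha₂,
        Set.inter_assoc, Set.inter_eq_right.2 hE]
    have hsub₂ : ∀ x, x ∩ D' = a' → x ∩ D₂ = a₂ := fun x hx => by
      rw [hsub x D₂ subset_rfl hx, Set.inter_eq_left.2 (𝓔.valid_subset hv₂)]
    refine ⟨(a', D'), hv', fun l hl => ?_, fun l hl => ?_, ?_, fun j => ?_, ?_, ε, ?_, ?_, ?_⟩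
    · rw [haE _ ((hD₀ l hl).trans Set.subset_union_left), hint l hl]
    · exact ((hD₀ l hl).trans Set.subset_union_left).trans (hD₂.trans hD')
    · rw [haE _ Set.subset_union_right]
      exact Set.inter_subset_left
    · obtain ⟨c, hc⟩ := hb₂ j
      refine ⟨max c i, fun i' ε' he => ?_⟩
      by_cases hi : i' = i
      · exact hi ▸ le_max_right _ _
      · rw [hne i' hi] at he
        exact (hc i' ε' he).trans (le_max_left _ _)
    · intro j hj i' ε' he
      have hi : i' ≠ i := by
        rintro rfl
        have := hev.symm.trans he
        simp only [Option.some.injEq, Prod.mk.injEq] at this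
        exact hj.ne' this.1
      exact hp₂ j hj i' ε' ((hne i' hi).symm.trans he)
    · refine ⟨i, hev, fun i' hi' ε' he => ?_⟩
      exact absurd (hb i' ε' ((hne i' hi'.ne').symm.trans he)) (not_le.2 (hbi.trans hi'))
    · exact fun hε x hx => ht hε x (hsub₂ x hx)
    · exact fun hε x hax hx => hf hε x hax (hsub₂ x hx)
  -- If a permitted extension lies in `U k`, a null part of it forces membership; if none does, `A`
  -- is kept, and failure of this very search gives the negative clause.
  by_cases hx : ∃ x ∈ U k, 𝓔.admissible x ∧ x ∩ D₁ = A ∧ 𝓔.Promise k A x ∧ 𝓔.Bounded x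
  · obtain ⟨x, hxU, hxa, hxD, hxp, hxb⟩ := hx
    obtain ⟨E, hE, hEU⟩ := hU k x hxU
    obtain ⟨D₂, hD₂, hv₂, hev⟩ := 𝓔.restrict hxa (hN.union_mem hD₁ hE)
    refine ⟨x ∩ D₂, D₂, true, hv₂, Set.subset_union_left.trans hD₂, ?_, fun j => ?_, ?_, ?_, ?_⟩
    · rw [Set.inter_assoc, Set.inter_eq_right.2 (Set.subset_union_left.trans hD₂), hxD]
    · obtain ⟨b, hb⟩ := hxb j
      exact ⟨b, fun i ε he => hb i ε (hev _ _ he)⟩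
    · exact fun j hj i ε he => hxp j hj i ε (hev _ _ he)
    · intro _ y hy
      refine hEU y ?_
      have hED : E ⊆ D₂ := Set.subset_union_right.trans hD₂
      rw [← Set.inter_eq_right.2 hED, ← Set.inter_assoc, hy, Set.inter_assoc]
    · simp
  · push Not at hx
    exact ⟨A, D₁, false, hv₁, subset_rfl, Set.inter_eq_left.2 (𝓔.valid_subset hv₁), hbd,
      fun j _ i ε he => he, by simp, fun _ x hxa hxD hxp hxb hxU => hx x hxU hxa hxD hxp hxb⟩

/-- For every sequence of open sets there is a point that belongs to exactly those whose last
event in the point is a positive one. The point avoids the intersection of the fronts. -/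
theorem exists_forall_mem_iff [RegularIndex K] [WellFoundedLT K] (𝓔 : EventSystem N)
    (hN : IsNullFamily N) {U : K → Set (Set K)} (hU : ∀ k, IsTraceOpen N (U k)) :
    ∃ x, Disjoint x (⋂ k, 𝓔.front k) ∧ ∀ k, x ∈ U k ↔ 𝓔.LastEvent x k true := by
  obtain ⟨s, hs⟩ := exists_seq_of_rel (𝓔.Stage U) (fun k s s' t => Stage.congr)
    (fun k s => exists_stage hN hU k s)
  have hs' : ∀ l ∈ (Set.univ : Set K), 𝓔.Stage U l s (s l) := fun l _ => hs l
  have hch := Stage.isChain hs'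
  have hadm := 𝓔.limit_admissible isLowerSet_univ hch
  have hbd := Stage.bounded_biUnion isLowerSet_univ hs'
  have hint := fun l => hch.biUnion_inter 𝓔.valid_subset (Set.mem_univ l)
  have hearly := fun i j ε => Stage.event_early isLowerSet_univ hs' (i := i) (j := j) (ε := ε)
  set x := ⋃ l ∈ Set.univ, (s l).1
  refine ⟨x, ?_, fun k => ?_⟩
  · refine Set.disjoint_left.2 fun y hy hyf => ?_
    obtain ⟨l, -, hl⟩ := Set.mem_iUnion₂.1 hy
    -- A point lying in every front can never be new at any stage, so its first appearance would
    -- descend forever.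
    induction l using WellFoundedLT.induction with
    | ind l ih =>
      obtain ⟨m, hm, hym⟩ := Set.mem_iUnion₂.1 ((hs l).front_subset ⟨hl, Set.mem_iInter.1 hyf l⟩)
      exact ih m hm hym
  obtain ⟨ε, hlast, ht, hf⟩ := (hs k).decide
  have hx : 𝓔.LastEvent x k ε := by
    obtain ⟨i, hi, hi'⟩ := hlast
    refine ⟨i, 𝓔.persist (hs k).valid (hint k) hi, fun i' hii ε' he => ?_⟩
    obtain ⟨m, -, hmk, hem⟩ := hearly _ _ _ he
    refine hi' i' hii ε' ?_
    rcases hmk.eq_or_lt with rfl | hmk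
    · exact hem
    · exact 𝓔.persist (hs m).valid ((hs k).inter_eq m hmk) hem
  cases ε with
  | true => exact iff_of_true (ht rfl x (hint k)) hx
  | false =>
    -- The final point satisfies the promise of stage `k`, since its events of label `j < k` already
    -- occur by stage `j`.
    refine iff_of_false (hf rfl x hadm (hint k) (fun j hj i ε he => ?_) hbd)
      fun h => Bool.noConfusion (hx.unique h)
    obtain ⟨m, -, hmj, hem⟩ := hearly _ _ _ he
    have hchk : IsApproxChain 𝓔.valid 𝓔.front (Set.Iio k) _ _ := hch.mono (Set.subset_univ _)
    exact 𝓔.persist (hs m).valid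
      (hchk.biUnion_inter 𝓔.valid_subset (l := m) (hmj.trans_lt hj)) hem

/-- Enlarge the fronts of an event system by a fixed null set. -/
def enlargeFront [RegularIndex K] (𝓔 : EventSystem N) (hN : IsNullFamily N) (C : Set K)
    (hC : C ∈ N) : EventSystem N :=
  { 𝓔 with
    front := fun k => 𝓔.front k ∪ C
    front_mem := fun k => hN.union_mem (𝓔.front_mem k) hC
    limit_ev := fun hJ h => 𝓔.limit_ev hJ (h.front_mono fun _ => Set.subset_union_left)
    limit_admissible := fun hJ h =>
      𝓔.limit_admissible hJ (h.front_mono fun _ => Set.subset_union_left)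
    limit_valid := fun h => 𝓔.limit_valid (h.front_mono fun _ => Set.subset_union_left) }

end EventSystem

end

/-! ### Restriction to a positive set, and the unsaturated case -/

section

variable {K : Type u} [LinearOrder K] {N : Set (Set K)}

/-- Events can be read off from sets by a local rule in such a way that every sequence of open
sets is decided by the last events of some point. -/
def HasDiagonalEvents (N : Set (Set K)) : Prop :=
  ∃ ev : Set K → K → Option (K × Bool),
    (∀ i, ∃ B ∈ N, ∀ x y, x ∩ B = y ∩ B → ev x i = ev y i) ∧
    ∀ U : K → Set (Set K), (∀ k, IsTraceOpen N (U k)) → ∃ x, ∀ k, x ∈ U k ↔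
      ∃ i, ev x i = some (k, true) ∧ ∀ i' > i, ∀ ε, ev x i' ≠ some (k, ε)

/-- The null family of the sets with null intersection with `A`. -/
def restrictTo (N : Set (Set K)) (A : Set K) : Set (Set K) := {D | D ∩ A ∈ N}

theorem IsNullFamily.restrictTo (hN : IsNullFamily N) {A : Set K} (hA : A ∉ N) :
    IsNullFamily (restrictTo N A) where
  mono h h' := hN.mono h (Set.inter_subset_inter_left _ h')
  iUnion_mem hι D hD := by
    rw [IdealBorel.restrictTo, Set.mem_ofPred_eq, Set.iUnion_inter]
    exact hN.iUnion_mem hι hD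
  univ_notMem h := hA (by simpa [IdealBorel.restrictTo] using h)
  Iic_mem k := hN.mono (hN.Iic_mem k) Set.inter_subset_left

/-- The complement of `A` is null for the restricted family, so it can be put into every front. The
constructed point then lies inside `A`, and reading events from `x ∩ A` makes them local for `N`
itself. -/
theorem hasDiagonalEvents_of_restrictTo [RegularIndex K] [WellFoundedLT K] (hN : IsNullFamily N)
    {A : Set K} (hA : A ∉ N) (𝓔 : EventSystem (restrictTo N A)) : HasDiagonalEvents N := by
  refine ⟨fun x => 𝓔.ev (x ∩ A), fun i => ?_, fun U hU => ?_⟩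
  · obtain ⟨B, hB, h⟩ := 𝓔.ev_local i
    refine ⟨B ∩ A, hB, fun x y hxy => h _ _ ?_⟩
    rwa [Set.inter_right_comm, Set.inter_assoc, Set.inter_right_comm, Set.inter_assoc y]
  · have hAc : Aᶜ ∈ restrictTo N A := by
      rw [restrictTo, Set.mem_ofPred_eq, Set.compl_inter_self]
      exact hN.empty_mem
    obtain ⟨x, hd, hx⟩ := (𝓔.enlargeFront (hN.restrictTo hA) Aᶜ hAc).exists_forall_mem_iff
      (hN.restrictTo hA) (U := U) fun k x hx => by
        obtain ⟨E, hE, h⟩ := hU k _ hx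
        exact ⟨E, hN.mono hE Set.inter_subset_left, h⟩
    have hxA : x ∩ A = x := by
      refine Set.inter_eq_left.2 fun y hy => ?_
      by_contra hyA
      exact Set.disjoint_left.1 hd hy (Set.mem_iInter.2 fun k => Or.inr hyA)
    refine ⟨x, fun k => ?_⟩
    simp only [hxA]
    exact hx k

/-- The event system of a map all of whose fibres are positive. -/
noncomputable def EventSystem.ofFibres [RegularIndex K] (hN : IsNullFamily N) (f : K → K × Bool)
    (hf : ∀ v, f ⁻¹' {v} ∉ N) : EventSystem N := by
  classical
  exact
  { ev := fun x i => if i ∈ x then some (f i) else none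
    valid := fun a D => a ⊆ D ∧ D ∈ N
    admissible := fun _ => True
    front := fun _ => ∅
    ev_local := fun i => ⟨Set.Iic i, hN.Iic_mem i, fun x y h => by
      have : i ∈ x ↔ i ∈ y := by simpa using Set.ext_iff.1 h i
      simp [this]⟩
    valid_mem := fun h => h.2
    valid_subset := fun h => h.1
    valid_mono := fun h h' h'' => ⟨h.1.trans h', h''⟩
    front_mem := fun _ => hN.empty_mem
    persist := fun {a D x i v} h hx he => by
      subst hx
      by_cases hi : i ∈ x ∩ D
      · simpa [hi, hi.1] using he
      · simp [hi] at he
    restrict := fun {x D} _ hD => ⟨D, subset_rfl, ⟨Set.inter_subset_right, hD⟩, fun i v he => by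
      by_cases hi : i ∈ x ∩ D
      · simpa [hi, hi.1] using he
      · simp [hi] at he⟩
    limit_ev := fun {J a D i v} _ _ he => by
      by_cases hi : i ∈ ⋃ l ∈ J, a l
      · obtain ⟨l, hl, hil⟩ := Set.mem_iUnion₂.1 hi
        exact ⟨l, hl, by simpa only [if_pos hi, if_pos hil] using he⟩
      · simp only [if_neg hi] at he
        cases he
    limit_admissible := fun _ _ => trivial
    limit_valid := fun {k a D} h => ⟨⋃ l < k, D l, fun l hl => Set.subset_biUnion_of_mem hl,
      Set.iUnion₂_mono fun l hl => (h.valid l hl).1,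
      hN.biUnion_Iio_mem k fun l hl => (h.valid l hl).2⟩
    add := fun {a D} h k j ε => by
      -- A positive fibre is not covered by a null set, so a fresh index with the required label
      -- exists beyond `k`.
      obtain ⟨i, hi, hiD⟩ : ∃ i ∈ f ⁻¹' {(j, ε)}, i ∉ D ∪ Set.Iic k := by
        by_contra hcon
        push Not at hcon
        exact hf (j, ε) (hN.mono (hN.union_mem h.2 (hN.Iic_mem k)) hcon)
      rw [Set.mem_union, not_or] at hiD
      refine ⟨insert i a, insert i D, i, ⟨Set.insert_subset_insert h.1, ?_⟩,
        Set.subset_insert _ _, ?_, not_le.1 hiD.2, ?_, fun i' hi' => ?_⟩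
      · refine hN.mono (hN.union_mem h.2 (hN.Iic_mem i)) ?_
        exact Set.insert_subset (Or.inr le_rfl) Set.subset_union_left
      · rw [Set.insert_inter_of_notMem hiD.1, Set.inter_eq_left.2 h.1]
      · simpa using hi
      · simp [hi'] }

end

/-! ### Saturation and least unbounded functions -/

section

variable {K : Type u} [LinearOrder K]

/-- No map has only positive fibres. -/
def IsSaturated (N : Set (Set K)) : Prop := ∀ f : K → K, ∃ k, f ⁻¹' {k} ∈ N

/-- `g` is unbounded on every positive set. -/
def IsUnboundedMod (N : Set (Set K)) (g : K → K) : Prop := ∀ β, {ξ | g ξ ≤ β} ∈ N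

/-- Every function below `g` is bounded on a positive set. -/
def IsMinimalMod (N : Set (Set K)) (g : K → K) : Prop :=
  ∀ B ∉ N, ∀ h : K → K, (∀ ξ ∈ B, h ξ < g ξ) → ∃ β, {ξ ∈ B | h ξ ≤ β} ∉ N

variable {N : Set (Set K)}

theorem IsSaturated.restrictTo (hN : IsNullFamily N) (hs : IsSaturated N) (A : Set K) :
    IsSaturated (restrictTo N A) := fun f => by
  obtain ⟨k, hk⟩ := hs f
  exact ⟨k, hN.mono hk Set.inter_subset_left⟩

theorem IsSaturated.exists_mem [RegularIndex K] (hN : IsNullFamily N) (hs : IsSaturated N)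
    {P : K → Set K} (hP : Pairwise fun k l => Disjoint (P k) (P l)) : ∃ k, P k ∈ N := by
  classical
  obtain ⟨k₀⟩ := mk_ne_zero_iff.1 (aleph0_pos.trans (RegularIndex.aleph0_lt (K := K))).ne'
  obtain ⟨k, hk⟩ := hs fun ξ => if h : ∃ k, ξ ∈ P k then h.choose else k₀
  refine ⟨k, hN.mono hk fun ξ hξ => ?_⟩
  have h : ∃ k, ξ ∈ P k := ⟨k, hξ⟩
  simp only [Set.mem_preimage, h, dif_pos, Set.mem_singleton_iff]
  by_contra hne
  exact Set.disjoint_left.1 (hP hne) h.choose_spec hξ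

theorem IsSaturated.mk_lt [RegularIndex K] (hN : IsNullFamily N) (hs : IsSaturated N)
    {𝓕 : Set (Set K)} (hpos : ∀ B ∈ 𝓕, B ∉ N) (hd : 𝓕.PairwiseDisjoint id) : #𝓕 < #K := by
  by_contra h
  obtain ⟨c⟩ := not_lt.1 h
  obtain ⟨k, hk⟩ := hs.exists_mem hN (P := fun k => (c k : Set K)) fun k l hkl =>
    hd (c k).2 (c l).2 fun h => hkl (c.injective (Subtype.ext h))
  exact hpos _ (c k).2 hk

theorem IsNullFamily.nonempty_of_compl_mem (hN : IsNullFamily N) {S : Set K} (hS : Sᶜ ∈ N) :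
    S.Nonempty := by
  by_contra h
  rw [Set.not_nonempty_iff_eq_empty.1 h, Set.compl_empty] at hS
  exact hN.univ_notMem hS

/-- A maximal disjoint family of positive sets carrying smaller unbounded functions covers almost
everything, and by saturation has fewer than κ members. By completeness the functions glue to one
that is still unbounded. -/
theorem exists_lt_of_forall_pos [RegularIndex K] (hN : IsNullFamily N) (hs : IsSaturated N)
    {g : K → K}
    (hg : ∀ A ∉ N, ∃ B ⊆ A, B ∉ N ∧ ∃ h : K → K, (∀ ξ ∈ B, h ξ < g ξ) ∧
      ∀ β, {ξ ∈ B | h ξ ≤ β} ∈ N) :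
    ∃ g', IsUnboundedMod N g' ∧ {ξ | ¬ g' ξ < g ξ} ∈ N := by
  classical
  let Good : Set K → Prop := fun B => B ∉ N ∧ ∃ h : K → K, (∀ ξ ∈ B, h ξ < g ξ) ∧
    ∀ β, {ξ ∈ B | h ξ ≤ β} ∈ N
  obtain ⟨𝓕, h𝓕⟩ := zorn_subset {𝓕 : Set (Set K) | (∀ B ∈ 𝓕, Good B) ∧ 𝓕.PairwiseDisjoint id}
    fun c hc hch => ⟨⋃₀ c, ⟨fun B ⟨𝓕, h𝓕, hB⟩ => (hc h𝓕).1 B hB,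
      (Set.pairwise_sUnion hch.directedOn).2 fun 𝓕 h𝓕 => (hc h𝓕).2⟩,
      fun s hs => Set.subset_sUnion_of_mem hs⟩
  obtain ⟨hgood, hdisj⟩ := h𝓕.prop
  have hcard := hs.mk_lt hN (fun B hB => (hgood B hB).1) hdisj
  have hcompl : (⋃₀ 𝓕)ᶜ ∈ N := by
    by_contra hpos
    obtain ⟨B, hBA, hB⟩ := hg _ hpos
    have hBd : ∀ C ∈ 𝓕, Disjoint B C := fun C hC =>
      Set.disjoint_left.2 fun ξ hξ hξC => hBA hξ ⟨C, hC, hξC⟩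
    have hmem : B ∈ 𝓕 := by
      refine h𝓕.le_of_ge (y := insert B 𝓕) ⟨?_, ?_⟩ (Set.subset_insert _ _) (Set.mem_insert _ _)
      · rintro C (rfl | hC)
        exacts [hB, hgood C hC]
      · exact hdisj.insert fun C hC _ => hBd C hC
    have hB0 := disjoint_self.1 (hBd B hmem)
    rw [Set.bot_eq_empty] at hB0
    exact hB.1 (hB0 ▸ hN.empty_mem)
  choose h hlt hunb using fun B : 𝓕 => (hgood B B.2).2
  refine ⟨fun ξ => if hξ : ∃ B : 𝓕, ξ ∈ (B : Set K) then h hξ.choose ξ else ξ, fun β => ?_, ?_⟩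
  · refine hN.mono (hN.union_mem hcompl (hN.iUnion_mem hcard fun B => hunb B β)) fun ξ hξ => ?_
    by_cases hξ' : ∃ B : 𝓕, ξ ∈ (B : Set K)
    · simp only [Set.mem_ofPred_eq, dif_pos hξ'] at hξ
      exact Or.inr (Set.mem_iUnion.2 ⟨hξ'.choose, hξ'.choose_spec, hξ⟩)
    · exact Or.inl fun ⟨B, hB, hξB⟩ => hξ' ⟨⟨B, hB⟩, hξB⟩
  · refine hN.mono hcompl fun ξ hξ => ?_
    rintro ⟨B, hB, hξB⟩
    have hξ' : ∃ B : 𝓕, ξ ∈ (B : Set K) := ⟨⟨B, hB⟩, hξB⟩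
    simp only [Set.mem_ofPred_eq, dif_pos hξ'] at hξ
    exact hξ (hlt _ ξ hξ'.choose_spec)

/-- A saturated null family has a least unbounded function on some positive set. -/
theorem exists_isMinimalMod [RegularIndex K] [WellFoundedLT K] (hN : IsNullFamily N)
    (hs : IsSaturated N) : ∃ A ∉ N, ∃ g, IsUnboundedMod (restrictTo N A) g ∧
      IsMinimalMod (restrictTo N A) g := by
  by_contra hcon
  push Not at hcon
  have hstep : ∀ g : {g // IsUnboundedMod N g}, ∃ g' : {g // IsUnboundedMod N g},
      {ξ | ¬ g'.1 ξ < g.1 ξ} ∈ N := by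
    rintro ⟨g, hg⟩
    obtain ⟨g', hg', h⟩ := exists_lt_of_forall_pos hN hs (g := g) fun A hA => by
      have := hcon A hA g fun β => hN.mono (hg β) Set.inter_subset_left
      simp only [IsMinimalMod] at this
      push Not at this
      obtain ⟨B, hB, h, hlt, hunb⟩ := this
      refine ⟨B ∩ A, Set.inter_subset_right, hB, h, fun ξ hξ => hlt ξ hξ.1, fun β => ?_⟩
      refine hN.mono (hunb β) ?_
      rintro ξ ⟨⟨h1, h2⟩, h3⟩
      exact ⟨⟨h1, h3⟩, h2⟩
    exact ⟨⟨g', hg'⟩, h⟩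
  choose next hnext using hstep
  -- If no least function existed, repeated descent from `id` would, outside countably many null
  -- sets, yield an infinite decreasing sequence at a single point.
  let G : ℕ → {g // IsUnboundedMod N g} := fun n =>
    next^[n] ⟨id, fun β => hN.Iic_mem β⟩
  have hG : ∀ n, G (n + 1) = next (G n) := fun n => Function.iterate_succ_apply' next n _
  have hnull := hN.iUnion_mem (ι := ULift ℕ) RegularIndex.mk_lt_of_countable
    (D := fun n => {ξ | ¬ (G (n.down + 1)).1 ξ < (G n.down).1 ξ}) fun n => by
      rw [hG]
      exact hnext _
  obtain ⟨ξ, hξ⟩ := hN.nonempty_of_compl_mem (S := (⋃ n : ULift.{u} ℕ,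
    {ξ | ¬ (G (n.down + 1)).1 ξ < (G n.down).1 ξ})ᶜ) (by rwa [compl_compl])
  simp only [Set.mem_compl_iff, Set.mem_iUnion, Set.mem_ofPred_eq, not_exists, not_not] at hξ
  exact (WellFounded.not_rel_apply_succ (r := (· < · : K → K → Prop)) fun n => (G n).1 ξ).elim
    fun n hn => hn (hξ ⟨n⟩)

/-! ### Pressing down and reflection for a minimal pair -/

/-- The points closed under `F`. -/
def closurePts (F : K → K) : Set K := {δ | (∃ η, η < δ) ∧ ∀ η < δ, F η < δ}

/-- The initial segment below `i` has no short unbounded sequence. -/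
def IsRegPt (i : K) : Prop :=
  ∀ η < i, ∀ f : K → K, (∀ l ≤ η, f l < i) → ∃ b < i, ∀ l ≤ η, f l ≤ b

/-- `X` meets below `i` the closure points of every function on the initial segment below `i`. -/
def IsStatAt (i : K) (X : Set K) : Prop :=
  ∀ f : K → K, (∀ η < i, f η < i) → ∃ δ ∈ X, δ < i ∧ δ ∈ closurePts f

variable (N) in
/-- A saturated null family with a least unbounded function. -/
structure IsMinimalPair (g : K → K) : Prop where
  null : IsNullFamily N
  saturated : IsSaturated N
  unbounded : IsUnboundedMod N g
  minimal : IsMinimalMod N g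

namespace IsMinimalPair

variable {g : K → K} [RegularIndex K] [WellFoundedLT K]

/-- Minimality gives a bound only on a positive set. If no bound worked almost everywhere, it would
produce κ many disjoint positive slabs `s k < h ξ ≤ β (s k)`, against saturation. -/
theorem exists_bound (H : IsMinimalPair N g) {B : Set K} {h : K → K} (hlt : ∀ ξ ∈ B, h ξ < g ξ) :
    ∃ b, {ξ ∈ B | b < h ξ} ∈ N := by
  by_contra hcon
  push Not at hcon
  choose β hβ using fun b => H.minimal _ (hcon b) h fun ξ hξ => hlt ξ hξ.1
  obtain ⟨k₀⟩ := mk_ne_zero_iff.1 (aleph0_pos.trans (RegularIndex.aleph0_lt (K := K))).ne'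
  have : Inhabited K := ⟨k₀⟩
  obtain ⟨s, hs⟩ := exists_seq_of_rel (K := K) (fun k (s : K → K) t => ∀ l < k, β (s l) ≤ t)
    (fun k s s' t h h' l hl => h l hl ▸ h' l hl) fun k s _ => by
      obtain ⟨b, hb⟩ := RegularIndex.exists_lt_Iic k fun l => β (s l)
      exact ⟨b, fun l hl => (hb l hl.le).le⟩
  obtain ⟨k, hk⟩ := H.saturated.exists_mem H.null
    (P := fun k => {ξ ∈ {ξ ∈ B | s k < h ξ} | h ξ ≤ β (s k)}) fun k l hkl => by
      refine Set.disjoint_left.2 fun ξ hξ hξ' => ?_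
      rcases lt_or_gt_of_ne hkl with hlt | hlt
      · exact absurd hξ'.1.2 (not_lt.2 (hξ.2.trans (hs l k hlt)))
      · exact absurd hξ.1.2 (not_lt.2 (hξ'.2.trans (hs k l hlt)))
  exact hβ _ hk

/-- The analogue of Fodor's lemma: an almost everywhere bounded function takes fewer than κ values
off a null set, so completeness makes one fibre positive. -/
theorem exists_const (H : IsMinimalPair N g) {B : Set K} (hB : B ∉ N) {h : K → K}
    (hlt : ∀ ξ ∈ B, h ξ < g ξ) : ∃ c, {ξ ∈ B | h ξ = c} ∉ N := by
  by_contra hcon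
  push Not at hcon
  obtain ⟨b, hb⟩ := H.exists_bound hlt
  refine hB (H.null.mono (H.null.union_mem hb (H.null.biUnion_Iic_mem b fun c _ => hcon c)) ?_)
  intro ξ hξ
  rcases lt_or_ge b (h ξ) with h' | h'
  · exact Or.inl ⟨hξ, h'⟩
  · exact Or.inr (Set.mem_iUnion₂.2 ⟨h ξ, h', hξ, rfl⟩)

/-- Otherwise some `η < g ξ` has `g ξ ≤ F η` on a positive set; pressing `η` down to a constant
bounds `g` on a positive set. -/
theorem closurePts_mem (H : IsMinimalPair N g) (F : K → K) : {ξ | g ξ ∉ closurePts F} ∈ N := by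
  classical
  obtain ⟨k₀⟩ := mk_ne_zero_iff.1 (aleph0_pos.trans (RegularIndex.aleph0_lt (K := K))).ne'
  by_contra hpos
  have hpos' : {ξ | ∃ η < g ξ, g ξ ≤ F η} ∉ N := by
    intro hn
    refine hpos (H.null.mono (H.null.union_mem hn (H.unbounded k₀)) fun ξ hξ => ?_)
    rcases le_or_gt (g ξ) k₀ with h | h
    · exact Or.inr h
    · refine Or.inl ?_
      by_contra hcon
      simp only [Set.mem_ofPred_eq] at hcon
      push Not at hcon
      exact hξ ⟨⟨k₀, h⟩, hcon⟩
  obtain ⟨c, hc⟩ := H.exists_const hpos'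
    (h := fun ξ => if h : ∃ η < g ξ, g ξ ≤ F η then h.choose else k₀) fun ξ hξ => by
      have hξ : ∃ η < g ξ, g ξ ≤ F η := hξ
      rw [dif_pos hξ]
      exact hξ.choose_spec.1
  refine hc (H.null.mono (H.unbounded (F c)) ?_)
  rintro ξ ⟨hξ, hξc⟩
  have hξ : ∃ η < g ξ, g ξ ≤ F η := hξ
  rw [dif_pos hξ] at hξc
  rw [← hξc]
  exact hξ.choose_spec.2

/-- Press the length of a short unbounded sequence in `g ξ` down to a constant `c`. Each of its
coordinates is then bounded almost everywhere, and regularity of κ gives one bound for all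
coordinates, which `g` almost always exceeds. -/
theorem isRegPt_mem (H : IsMinimalPair N g) : {ξ | ¬ IsRegPt (g ξ)} ∈ N := by
  by_contra hpos
  have hbad : ∀ ξ, ∃ (η : K) (f : K → K), ¬ IsRegPt (g ξ) → η < g ξ ∧ (∀ l ≤ η, f l < g ξ) ∧
      ∀ b < g ξ, ∃ l ≤ η, b < f l := by
    intro ξ
    by_cases h : IsRegPt (g ξ)
    · exact ⟨ξ, id, fun h' => absurd h h'⟩
    · have h' := h
      simp only [IsRegPt] at h'
      push Not at h'
      obtain ⟨η, hη, f, hf, hb⟩ := h'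
      exact ⟨η, f, fun _ => ⟨hη, hf, hb⟩⟩
  choose η f hf using hbad
  obtain ⟨c, hc⟩ := H.exists_const hpos (h := η) fun ξ hξ => (hf ξ hξ).1
  have hlt : ∀ l, ∃ b, l ≤ c → {ξ ∈ {ξ ∈ {ξ | ¬ IsRegPt (g ξ)} | η ξ = c} | b < f ξ l} ∈ N := by
    intro l
    by_cases hl : l ≤ c
    · obtain ⟨b, hb⟩ := H.exists_bound (B := {ξ ∈ {ξ | ¬ IsRegPt (g ξ)} | η ξ = c})
        (h := fun ξ => f ξ l) fun ξ hξ => (hf ξ hξ.1).2.1 l (hξ.2 ▸ hl)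
      exact ⟨b, fun _ => hb⟩
    · exact ⟨c, fun h => absurd h hl⟩
  choose b hb using hlt
  obtain ⟨b', hb'⟩ := RegularIndex.exists_lt_Iic c b
  refine hc (H.null.mono (H.null.union_mem (H.null.biUnion_Iic_mem c hb) (H.unbounded b')) ?_)
  intro ξ hξ
  rcases le_or_gt (g ξ) b' with h | h
  · exact Or.inr h
  · obtain ⟨l, hl, hbl⟩ := (hf ξ hξ.1).2.2 b' h
    have hl : l ≤ c := hξ.2 ▸ hl
    exact Or.inl (Set.mem_iUnion₂.2 ⟨l, hl, hξ, (hb' l hl).trans hbl⟩)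

/-- If reflection failed at every regular point, choose functions `f ξ` witnessing nonstationarity
below `g ξ` and bound each coordinate almost everywhere by `b η`. A value `g ξ₀`, with `ξ₀ ∈ S`,
closed under `b` is then closed under `f ξ` for some `ξ` with `g ξ₀ < g ξ`, a contradiction. -/
theorem exists_isStatAt (H : IsMinimalPair N g) {S : Set K} (hS : Sᶜ ∈ N) :
    ∃ i, IsRegPt i ∧ IsStatAt i (g '' S) := by
  by_contra hcon
  push Not at hcon
  have hbad : ∀ ξ, ∃ f : K → K, IsRegPt (g ξ) → (∀ η < g ξ, f η < g ξ) ∧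
      ∀ δ ∈ g '' S, δ < g ξ → δ ∉ closurePts f := by
    intro ξ
    by_cases h : IsRegPt (g ξ)
    · have h' := hcon _ h
      simp only [IsStatAt] at h'
      push Not at h'
      obtain ⟨f, hf⟩ := h'
      exact ⟨f, fun _ => hf⟩
    · exact ⟨id, fun h' => absurd h' h⟩
  choose f hf using hbad
  choose b hb using fun η => H.exists_bound (B := {ξ | IsRegPt (g ξ) ∧ η < g ξ})
    (h := fun ξ => f ξ η) fun ξ hξ => (hf ξ hξ.1).1 η hξ.2
  obtain ⟨ξ₀, hξ₀S, hξ₀⟩ := H.null.nonempty_of_compl_mem (S := S ∩ {ξ | g ξ ∈ closurePts b}) <|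
    H.null.mono (H.null.union_mem hS (H.closurePts_mem b)) (by rw [Set.compl_inter]; rfl)
  have hnull := H.null.union_mem (H.null.union_mem H.isRegPt_mem (H.unbounded (g ξ₀)))
    (H.null.biUnion_Iio_mem (g ξ₀) fun η _ => hb η)
  obtain ⟨ξ, hξ⟩ := H.null.nonempty_of_compl_mem (by rwa [compl_compl] : (_ᶜ)ᶜ ∈ N)
  simp only [Set.mem_compl_iff, Set.mem_union, not_or, Set.mem_ofPred_eq, not_not, not_le,
    Set.mem_iUnion, not_exists, not_and, not_lt] at hξ
  obtain ⟨⟨hreg, hlt⟩, hfb⟩ := hξ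
  exact (hf ξ hreg).2 (g ξ₀) ⟨ξ₀, hξ₀S, rfl⟩ hlt
    ⟨hξ₀.1, fun η hη => (hfb η hη ⟨hreg, hη.trans hlt⟩).trans_lt (hξ₀.2 η hη)⟩

end IsMinimalPair

end

/-! ### Labelling stationary subsets of initial segments -/

theorem exists_injective_choice {T S : Type u} (F : T → Set S) (hF : ∀ t, #T ≤ #(F t)) :
    ∃ c : T → S, Function.Injective c ∧ ∀ t, c t ∈ F t := by
  classical
  rcases isEmpty_or_nonempty T with h | ⟨⟨t₀⟩⟩
  · exact ⟨fun t => h.elim t, fun t => h.elim t, fun t => h.elim t⟩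
  obtain ⟨e⟩ : Nonempty ((#T).ord.ToType ≃ T) := Cardinal.eq.1 (mk_ord_toType _)
  obtain ⟨x₀, -⟩ : (F t₀).Nonempty := by
    rw [← Set.nonempty_coe_sort, ← mk_ne_zero_iff]
    exact fun h => mk_ne_zero_iff.2 ⟨t₀⟩ (le_zero_iff.1 (h ▸ hF t₀))
  have : Inhabited S := ⟨x₀⟩
  obtain ⟨s, hs⟩ := exists_seq_of_rel (K := (#T).ord.ToType)
    (fun k (s : (#T).ord.ToType → S) x => x ∈ F (e k) ∧ ∀ l < k, s l ≠ x)
    (fun k s s' x h h' => ⟨h'.1, fun l hl => h l hl ▸ h'.2 l hl⟩) fun k s _ => by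
      by_contra hcon
      push Not at hcon
      have hsub : F (e k) ⊆ s '' Set.Iio k := hcon
      have hlt := mk_Iio_lt k (by rw [mk_ord_toType, type_toType])
      rw [mk_ord_toType] at hlt
      exact absurd ((hF (e k)).trans ((mk_le_mk_of_subset hsub).trans mk_image_le)) (not_le.2 hlt)
  refine ⟨s ∘ e.symm, Function.Injective.comp (fun k l hkl => ?_) e.symm.injective, fun t => ?_⟩
  · by_contra hne
    rcases lt_or_gt_of_ne hne with h | h
    · exact (hs l).2 k h hkl
    · exact (hs k).2 l h hkl.symm
  · simpa using (hs (e.symm t)).1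

section

variable {K : Type u} [LinearOrder K]

/-- Agreement below `i` up to a bounded set. -/
def AgreeBelow (i : K) (X Y : Set K) : Prop := ∃ η < i, ∀ δ, η < δ → δ < i → (δ ∈ X ↔ δ ∈ Y)

theorem AgreeBelow.symm {i : K} {X Y : Set K} (h : AgreeBelow i X Y) : AgreeBelow i Y X := by
  obtain ⟨η, hη, h⟩ := h
  exact ⟨η, hη, fun δ h1 h2 => (h δ h1 h2).symm⟩

theorem AgreeBelow.trans {i : K} {X Y Z : Set K} (h : AgreeBelow i X Y) (h' : AgreeBelow i Y Z) :
    AgreeBelow i X Z := by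
  obtain ⟨η, hη, h⟩ := h
  obtain ⟨η', hη', h'⟩ := h'
  exact ⟨max η η', max_lt hη hη', fun δ h1 h2 =>
    (h δ ((le_max_left _ _).trans_lt h1) h2).trans (h' δ ((le_max_right _ _).trans_lt h1) h2)⟩

theorem IsStatAt.mono {i : K} {X Y : Set K} (h : IsStatAt i X) (hXY : ∀ δ ∈ X, δ < i → δ ∈ Y) :
    IsStatAt i Y := fun f hf => by
  obtain ⟨δ, h1, h2, h3⟩ := h f hf
  exact ⟨δ, hXY δ h1 h2, h2, h3⟩

theorem IsStatAt.exists_between {i : K} {X : Set K} (h : IsStatAt i X) {η : K} (hη : η < i) :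
    ∃ δ ∈ X, η < δ ∧ δ < i := by
  obtain ⟨δ, h1, h2, ⟨η', h3⟩, h4⟩ := h (fun _ => η) fun _ _ => hη
  exact ⟨δ, h1, h4 η' h3, h2⟩

theorem IsStatAt.exists_lt [Nonempty K] {i : K} {X : Set K} (h : IsStatAt i X) : ∃ η, η < i := by
  by_contra hcon
  push Not at hcon
  obtain ⟨δ, h1, h2, h3⟩ := h id fun η hη => absurd hη (not_lt.2 (hcon η))
  exact absurd h2 (not_lt.2 (hcon δ))

theorem IsStatAt.of_agreeBelow {i : K} {X Y : Set K} (h : IsStatAt i X) (hXY : AgreeBelow i X Y) :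
    IsStatAt i Y := fun f hf => by
  obtain ⟨η, hη, hXY⟩ := hXY
  obtain ⟨δ, h1, h2, ⟨η', h3⟩, h4⟩ := h (fun l => max (f l) η) fun l hl => max_lt (hf l hl) hη
  exact ⟨δ, (hXY δ ((le_max_right _ _).trans_lt (h4 η' h3)) h2).1 h1, h2, ⟨η', h3⟩,
    fun l hl => (le_max_left _ _).trans_lt (h4 l hl)⟩

theorem IsStatAt.or_of_union {i : K} {X Y : Set K} (h : IsStatAt i (X ∪ Y)) :
    IsStatAt i X ∨ IsStatAt i Y := by
  by_contra hcon
  push Not at hcon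
  obtain ⟨hX, hY⟩ := hcon
  simp only [IsStatAt] at hX hY
  push Not at hX hY
  obtain ⟨f, hf, hfX⟩ := hX
  obtain ⟨f', hf', hfY⟩ := hY
  obtain ⟨δ, h1, h2, h3, h4⟩ := h (fun l => max (f l) (f' l)) fun l hl => max_lt (hf l hl) (hf' l hl)
  rcases h1 with h1 | h1
  · exact hfX δ h1 h2 ⟨h3, fun l hl => (le_max_left _ _).trans_lt (h4 l hl)⟩
  · exact hfY δ h1 h2 ⟨h3, fun l hl => (le_max_right _ _).trans_lt (h4 l hl)⟩

/-- A stationary set contains an injective copy of the initial segment whose removal leaves a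
stationary set. -/
theorem IsStatAt.exists_removable [WellFoundedLT K] {i : K} (hi : IsRegPt i) {R : Set K}
    (hR : IsStatAt i R) : ∃ s : K → K, (∀ k < i, s k ∈ R ∧ s k < i) ∧
      (∀ k < i, ∀ l < k, s l < s k) ∧ IsStatAt i (R \ s '' Set.Iio i) := by
  classical
  choose! s₀ hs₀R hs₀ hs₀i using fun η (hη : η < i) => hR.exists_between hη
  have : Inhabited K := ⟨i⟩
  -- Each value is some `s₀ η > η`, so no closure point of `s₀` lies in the range. Removing the
  -- range therefore preserves stationarity.
  obtain ⟨s, hs⟩ := exists_seq_of_rel (K := K) (fun k (s : K → K) t => k < i →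
    (∃ η < i, t = s₀ η) ∧ ∀ l < k, s l < t)
    (fun k s s' t h h' hk => ⟨(h' hk).1, fun l hl => h l hl ▸ (h' hk).2 l hl⟩) fun k s hs => by
      by_cases hk : k < i
      · have hsi : ∀ l < k, s l < i := fun l hl => by
          obtain ⟨⟨η, hη, he⟩, -⟩ := hs l hl (hl.trans hk)
          exact he ▸ hs₀i η hη
        obtain ⟨b, hb, hbs⟩ := hi k hk (fun l => if l < k then s l else k) fun l _ => by
          split_ifs with h
          exacts [hsi l h, hk]
        refine ⟨s₀ b, fun _ => ⟨⟨b, hb, rfl⟩, fun l hl => ?_⟩⟩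
        have := hbs l hl.le
        rw [if_pos hl] at this
        exact this.trans_lt (hs₀ b hb)
      · exact ⟨k, fun h => absurd h hk⟩
  refine ⟨s, fun k hk => ?_, fun k hk => (hs k hk).2, fun f hf => ?_⟩
  · obtain ⟨⟨η, hη, he⟩, -⟩ := hs k hk
    exact he ▸ ⟨hs₀R η hη, hs₀i η hη⟩
  · obtain ⟨δ, h1, h2, h3, h4⟩ := hR (fun l => max (f l) (s₀ l)) fun l hl =>
      max_lt (hf l hl) (hs₀i l hl)
    refine ⟨δ, ⟨h1, ?_⟩, h2, h3, fun l hl => (le_max_left _ _).trans_lt (h4 l hl)⟩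
    rintro ⟨k, hk, rfl⟩
    obtain ⟨⟨η, hη, he⟩, -⟩ := hs k hk
    have := h4 η (he ▸ hs₀ η hη)
    rw [he] at this
    exact absurd ((le_max_right _ _).trans_lt this) (lt_irrefl _)

/-- Otherwise `Set.Iic η` could be mapped onto `Set.Iio i`, giving a short unbounded sequence in
`i`. -/
theorem IsRegPt.mk_Iic_lt {i η : K} (hi : IsRegPt i) (hη : η < i)
    (hlim : ∀ b < i, ∃ c < i, b < c) : #(Set.Iic η) < #(Set.Iio i) := by
  classical
  by_contra hcon
  obtain ⟨e⟩ := not_lt.1 hcon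
  have : Nonempty (Set.Iio i) := ⟨⟨η, hη⟩⟩
  obtain ⟨b, hb, hbf⟩ := hi η hη
    (fun l => if h : l ≤ η then (Function.invFun e ⟨l, h⟩ : Set.Iio i) else l) fun l hl => by
      simp only [dif_pos hl]
      exact Subtype.coe_prop (Function.invFun e ⟨l, hl⟩)
  obtain ⟨c, hc, hbc⟩ := hlim b hb
  have := hbf (e ⟨c, hc⟩) (e ⟨c, hc⟩).2
  simp only [dif_pos (show (e ⟨c, hc⟩ : K) ≤ η from (e ⟨c, hc⟩).2),
    Function.leftInverse_invFun e.injective _] at this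
  exact absurd hbc (not_lt.2 this)

/-- There are as many stationary subsets of a stationary set, modulo bounded sets, as
there are subsets of the initial segment. -/
theorem IsStatAt.exists_family [WellFoundedLT K] {i : K} (hi : IsRegPt i) {R G : Set K}
    (hR : IsStatAt i R) (hG : Disjoint G R) : ∃ r : Set (Set.Iio i) → Set K,
      (∀ w, r w ⊆ R ∧ IsStatAt i (r w)) ∧
      ∀ w w', AgreeBelow i (G ∪ r w) (G ∪ r w') → w ⊆ w' := by
  have : Nonempty K := ⟨i⟩
  have hlim : ∀ b < i, ∃ c < i, b < c := fun b hb => by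
    obtain ⟨δ, -, h1, h2⟩ := hR.exists_between hb
    exact ⟨δ, h2, h1⟩
  have hinf : ℵ₀ ≤ #(Set.Iio i) := by
    obtain ⟨η, hη⟩ := hR.exists_lt
    have : Nonempty (Set.Iio i) := ⟨⟨η, hη⟩⟩
    have : NoMaxOrder (Set.Iio i) := ⟨fun b => by
      obtain ⟨c, hc, hbc⟩ := hlim b b.2
      exact ⟨⟨c, hc⟩, hbc⟩⟩
    exact aleph0_le_mk _
  obtain ⟨s, hsR, hsm, hst⟩ := hR.exists_removable hi
  have hinj : ∀ k < i, ∀ l < i, s k = s l → k = l := by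
    intro k hk l hl h
    by_contra hne
    rcases lt_or_gt_of_ne hne with h' | h'
    · exact (hsm l hl k h').ne h
    · exact (hsm k hk l h').ne' h
  -- The removable copy splits into blocks indexed by `γ < i`, each unbounded in `i`. Removing
  -- exactly the blocks with `γ ∈ w` makes `w` recoverable modulo bounded sets.
  obtain ⟨e⟩ : Nonempty (Set.Iio i × Set.Iio i ≃ Set.Iio i) := Cardinal.eq.1 <| by
    rw [mk_prod, Cardinal.lift_id, mul_eq_self hinf]
  have hunb : ∀ γ : Set.Iio i, ∀ η < i, ∃ ζ, η < s (e (γ, ζ)) := by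
    intro γ η hη
    by_contra hcon
    push Not at hcon
    refine absurd (mk_le_of_injective (f := fun ζ => (⟨s (e (γ, ζ)), hcon ζ⟩ : Set.Iic η)) ?_)
      (not_le.2 (hi.mk_Iic_lt hη hlim))
    intro ζ ζ' h
    have h1 := hinj _ (e (γ, ζ)).2 _ (e (γ, ζ')).2 (Subtype.mk.inj h)
    exact (Prod.mk.inj (e.injective (Subtype.ext h1))).2
  refine ⟨fun w => R \ {δ | ∃ γ ∈ w, ∃ ζ, δ = s (e (γ, ζ))}, fun w => ⟨Set.sdiff_subset, ?_⟩,
    fun w w' ⟨η, hη, h⟩ γ hγ => ?_⟩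
  · refine hst.mono fun δ hδ _ => ⟨hδ.1, ?_⟩
    rintro ⟨γ, -, ζ, rfl⟩
    exact hδ.2 ⟨_, (e (γ, ζ)).2, rfl⟩
  · by_contra hγ'
    obtain ⟨ζ, hζ⟩ := hunb γ η hη
    obtain ⟨h1, h2⟩ := hsR _ (e (γ, ζ)).2
    have hnG : s (e (γ, ζ)) ∉ G := fun h => Set.disjoint_left.1 hG h h1
    have hmem : s (e (γ, ζ)) ∈ G ∪ (R \ {δ | ∃ γ ∈ w', ∃ ζ, δ = s (e (γ, ζ))}) := by
      refine Or.inr ⟨h1, ?_⟩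
      rintro ⟨γ', hγ'w, ζ', he⟩
      have := hinj _ (e (γ, ζ)).2 _ (e (γ', ζ')).2 he
      have := (Prod.mk.inj (e.injective (Subtype.ext this))).1
      exact hγ' (this ▸ hγ'w)
    rcases (h _ hζ h2).2 hmem with h | h
    · exact hnG h
    · exact h.2 ⟨γ, hγ, ζ, rfl⟩

/-- Subsets of a regular initial segment can be labelled, invariantly modulo bounded sets, so that
every stationary set has stationary subsets of each label. -/
theorem exists_label [WellFoundedLT K] (i : K) (hi : IsRegPt i) : ∃ ℓ : Set K → K × Bool,
    (∀ X Y, AgreeBelow i X Y → ℓ X = ℓ Y) ∧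
    ∀ R G, IsStatAt i R → Disjoint G R → ∀ j < i, ∀ ε,
      ∃ R' ⊆ R, IsStatAt i R' ∧ ℓ (G ∪ R') = (j, ε) := by
  classical
  have : Nonempty K := ⟨i⟩
  by_cases hex : ∃ R, IsStatAt i R
  swap
  · exact ⟨fun _ => (i, true), fun _ _ _ => rfl, fun R G hR => absurd ⟨R, hR⟩ hex⟩
  obtain ⟨R₀, hR₀⟩ := hex
  obtain ⟨η₀, hη₀⟩ := hR₀.exists_lt
  let rel : Setoid (Set K) := ⟨AgreeBelow i, fun _ => ⟨η₀, hη₀, fun _ _ _ => Iff.rfl⟩,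
    AgreeBelow.symm, AgreeBelow.trans⟩
  have hinf : ℵ₀ ≤ #(Set.Iio i) := by
    have : Nonempty (Set.Iio i) := ⟨⟨η₀, hη₀⟩⟩
    have : NoMaxOrder (Set.Iio i) := ⟨fun b => by
      obtain ⟨c, -, hbc, hc⟩ := hR₀.exists_between b.2
      exact ⟨⟨c, hc⟩, hbc⟩⟩
    exact aleph0_le_mk _
  -- There are at most as many tasks (stationary set, fixed part, label) as subsets of `i`, and each
  -- has at least that many solutions modulo bounded sets. So distinct tasks can be assigned
  -- distinct classes, each labelled by its task.
  let T := {t : Set (Set.Iio i) × Set (Set.Iio i) × Set.Iio i × Bool //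
    IsStatAt i (Subtype.val '' t.1) ∧ Disjoint t.2.1 t.1}
  have hT : #T ≤ #(Set (Set.Iio i)) := by
    refine (mk_subtype_le _).trans ?_
    have h1 : #(Set.Iio i) ≤ #(Set (Set.Iio i)) := by
      rw [mk_set]
      exact (cantor _).le
    have h2 : ℵ₀ ≤ #(Set (Set.Iio i)) := hinf.trans h1
    simp only [mk_prod, Cardinal.lift_id, Cardinal.lift_uzero]
    refine mul_le_of_le h2 le_rfl (mul_le_of_le h2 le_rfl (mul_le_of_le h2 h1 ?_))
    exact (lift_le_aleph0.2 mk_le_aleph0).trans h2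
  obtain ⟨c, hc, hcF⟩ := exists_injective_choice (T := T)
    (fun t => {q : Quotient rel | ∃ R' ⊆ Subtype.val '' t.1.1, IsStatAt i R' ∧
      q = Quotient.mk rel (Subtype.val '' t.1.2.1 ∪ R')}) fun t => by
      obtain ⟨r, hr, hrw⟩ := t.2.1.exists_family hi
        ((Set.disjoint_image_iff Subtype.val_injective).2 t.2.2)
      refine hT.trans (mk_le_of_injective (f := fun w =>
        ⟨Quotient.mk rel (Subtype.val '' t.1.2.1 ∪ r w), r w, (hr w).1, (hr w).2, rfl⟩) ?_)
      intro w w' h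
      have h : AgreeBelow i _ _ := Quotient.exact (Subtype.mk.inj h)
      exact (hrw _ _ h).antisymm (hrw _ _ h.symm)
  refine ⟨fun X => if h : ∃ t : T, c t = Quotient.mk rel X then
    (h.choose.1.2.2.1, h.choose.1.2.2.2) else (i, true), fun X Y h => ?_,
    fun R G hR hGR j hj ε => ?_⟩
  · have : Quotient.mk rel X = Quotient.mk rel Y := Quotient.sound h
    simp only [this]
  · let t : T := ⟨(Subtype.val ⁻¹' R, Subtype.val ⁻¹' G, ⟨j, hj⟩, ε),
      hR.mono fun δ h1 h2 => ⟨⟨δ, h2⟩, h1, rfl⟩, hGR.preimage _⟩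
    obtain ⟨R', hR', hst, he⟩ := hcF t
    have hag : AgreeBelow i (Subtype.val '' t.1.2.1 ∪ R') (G ∪ R') := by
      refine ⟨η₀, hη₀, fun δ _ hδ => or_congr ⟨?_, fun h => ⟨⟨δ, hδ⟩, h, rfl⟩⟩ Iff.rfl⟩
      rintro ⟨x, hx, rfl⟩
      exact hx
    have he : c t = Quotient.mk rel (G ∪ R') := he.trans (Quotient.sound hag)
    have hex : ∃ t : T, c t = Quotient.mk rel (G ∪ R') := ⟨t, he⟩
    refine ⟨R', fun δ hδ => ?_, hst, ?_⟩
    · obtain ⟨x, hx, rfl⟩ := hR' hδ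
      exact hx
    · have : hex.choose = t := hc (hex.choose_spec.trans he.symm)
      simp only [dif_pos hex, this]
      rfl

end

/-! ### The event system of a minimal pair -/

section

variable {K : Type u} [LinearOrder K] {N : Set (Set K)} {g : K → K}

open Classical in
/-- The event at `i`: the label of the trace of `x` if that trace is stationary. -/
noncomputable def statEvent (g : K → K) (ℓ : K → Set K → K × Bool) (x : Set K) (i : K) :
    Option (K × Bool) :=
  if IsRegPt i ∧ IsStatAt i (g '' x) then some (ℓ i (g '' x)) else none

/-- The labels are invariant modulo bounded sets. -/
def IsInvariantLabel (ℓ : K → Set K → K × Bool) : Prop :=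
  ∀ i, IsRegPt i → ∀ X Y, AgreeBelow i X Y → ℓ i X = ℓ i Y

variable {ℓ : K → Set K → K × Bool} {i : K} {v : K × Bool} {x y : Set K}

theorem statEvent_eq_some :
    statEvent g ℓ x i = some v ↔ IsRegPt i ∧ IsStatAt i (g '' x) ∧ ℓ i (g '' x) = v := by
  classical
  rw [statEvent]
  split_ifs with h
  · simp [h]
  · simp only [false_iff]
    exact fun h' => h ⟨h'.1, h'.2.1⟩

theorem statEvent_congr (hℓ : IsInvariantLabel ℓ) (h : AgreeBelow i (g '' x) (g '' y)) :
    statEvent g ℓ x i = statEvent g ℓ y i := by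
  ext v
  simp only [statEvent_eq_some]
  refine and_congr_right fun hi => ?_
  rw [hℓ i hi _ _ h]
  exact and_congr_left fun _ => ⟨fun h' => h'.of_agreeBelow h, fun h' => h'.of_agreeBelow h.symm⟩

theorem statEvent_congr_of_forall (hℓ : IsInvariantLabel ℓ)
    (h : ∀ δ < i, δ ∈ g '' x ↔ δ ∈ g '' y) : statEvent g ℓ x i = statEvent g ℓ y i := by
  by_cases hi : ∃ η, η < i
  · obtain ⟨η, hη⟩ := hi
    exact statEvent_congr hℓ ⟨η, hη, fun δ _ hδ => h δ hδ⟩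
  · have : Nonempty K := ⟨i⟩
    have hn : ∀ X, ¬ IsStatAt i X := fun X hX => hi hX.exists_lt
    ext v
    simp [statEvent_eq_some, hn]

theorem IsStatAt.exists_escape {X : Set K} {F : K → K} (h : IsStatAt i X)
    (hF : ∀ δ ∈ X, δ ∉ closurePts F) : ∃ η < i, i ≤ F η := by
  by_contra hcon
  push Not at hcon
  obtain ⟨δ, h1, -, h2⟩ := h F hcon
  exact hF δ h1 h2

theorem notMem_closurePts_of_escape {F : K → K} {η δ : K} (hF : i ≤ F η) (hη : η < δ)
    (hδ : δ < i) : δ ∉ closurePts F := fun h => absurd (h.2 η hη) (not_lt.2 (hδ.le.trans hF))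

theorem closurePts_anti {F F' : K → K} (h : ∀ η, F η ≤ F' η) : closurePts F' ⊆ closurePts F :=
  fun _ hδ => ⟨hδ.1, fun η hη => (h η).trans_lt (hδ.2 η hη)⟩

/-- `F` witnesses that `a` is an approximation with domain `D`. -/
def IsWitness (g : K → K) (a D : Set K) (F : K → K) : Prop :=
  (∀ ξ ∈ a, g ξ ∉ closurePts F) ∧ ∀ ξ, g ξ ∉ closurePts F → ξ ∈ D

/-- Once `F η ≥ i`, no closure point of `F` lies strictly between `η` and `i`, so `D` already
decides everything whose `g`-value is there. -/
theorem IsWitness.agreeBelow {a D : Set K} {F : K → K} (h : IsWitness g a D F) (hx : x ∩ D = a)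
    {η : K} (hη : η < i) (hF : i ≤ F η) : AgreeBelow i (g '' a) (g '' x) := by
  refine ⟨η, hη, fun δ h1 h2 => ⟨?_, ?_⟩⟩
  · rintro ⟨ξ, hξ, rfl⟩
    rw [← hx] at hξ
    exact ⟨ξ, hξ.1, rfl⟩
  · rintro ⟨ξ, hξ, rfl⟩
    exact ⟨ξ, hx ▸ ⟨hξ, h.2 ξ (notMem_closurePts_of_escape hF h1 h2)⟩, rfl⟩

/-- Approximations of the event system of a minimal pair. -/
def StatValid (N : Set (Set K)) (g : K → K) (a D : Set K) : Prop := D ∈ N ∧ ∃ F, IsWitness g a D F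

/-- A diagonal intersection of clubs. By the fronts, a point new at stage `l` has `g ξ > l`, so a
closure point of the diagonal bound `f` at `g ξ` would also be one of `F l`. -/
theorem notMem_closurePts_of_diagonal [WellFoundedLT K] {J : Set K} (hJ : IsLowerSet J)
    {a D F : K → _}
    (hc : IsApproxChain (StatValid N g) (fun l => {ξ | g ξ ≤ l}) J a D)
    (hF : ∀ l ∈ J, IsWitness g (a l) (D l) (F l)) {ξ : K} (hξ : ξ ∈ ⋃ l ∈ J, a l) {f : K → K}
    (hf : ∀ η < g ξ, ∀ l ∈ J, l ≤ η → ∀ η' ≤ η, F l η' ≤ f η) : g ξ ∉ closurePts f := by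
  obtain ⟨l, hl, hξl⟩ := Set.mem_iUnion₂.1 hξ
  induction l using WellFoundedLT.induction with
  | ind l ih =>
    rcases le_or_gt (g ξ) l with hle | hlt
    · obtain ⟨m, hm, hξm⟩ := Set.mem_iUnion₂.1 (hc.front_subset l hl ⟨hξl, hle⟩)
      exact ih m hm (hJ (le_of_lt hm) hl) hξm
    · refine fun hcl => (hF l hl).1 ξ hξl ⟨hcl.1, fun η hη => ?_⟩
      have hm : max l η < g ξ := max_lt hlt hη
      exact (hf _ hm l hl (le_max_left _ _) η (le_max_right _ _)).trans_lt (hcl.2 _ hm)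

theorem IsRegPt.exists_bound₂ {η : K} (hi : IsRegPt i) (hη : η < i) {F : K → K → K}
    (hF : ∀ l ≤ η, ∀ η' ≤ η, F l η' < i) : ∃ b < i, ∀ l ≤ η, ∀ η' ≤ η, F l η' ≤ b := by
  choose! b hb hbF using fun l (hl : l ≤ η) => hi η hη (F l) (hF l hl)
  obtain ⟨c, hc, hcb⟩ := hi η hη b hb
  exact ⟨c, hc, fun l hl η' hη' => (hbF l hl η' hη').trans (hcb l hl)⟩

theorem RegularIndex.exists_bound₂ [RegularIndex K] (η : K) (F : K → K → K) :
    ∃ b, ∀ l ≤ η, ∀ η' ≤ η, F l η' ≤ b := by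
  choose b hb using fun l => RegularIndex.exists_lt_Iic η (F l)
  obtain ⟨c, hc⟩ := RegularIndex.exists_lt_Iic η b
  exact ⟨c, fun l hl η' hη' => ((hb l η' hη').trans (hc l hl)).le⟩

/-- Either some `F l` escapes `i`, and then `a l` agrees with the union below `i` modulo a bounded
set; or all `F l` map `i` into `i`, and their diagonal bound, which exists by regularity of `i`,
contradicts stationarity of the union. -/
theorem limit_statEvent [WellFoundedLT K] (hℓ : IsInvariantLabel ℓ) {J : Set K} (hJ : IsLowerSet J)
    {a D : K → Set K}
    (hc : IsApproxChain (StatValid N g) (fun l => {ξ | g ξ ≤ l}) J a D)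
    (he : statEvent g ℓ (⋃ l ∈ J, a l) i = some v) : ∃ l ∈ J, statEvent g ℓ (a l) i = some v := by
  classical
  choose! F hF using fun l hl => (hc.valid l hl).2
  obtain ⟨hi, hst, -⟩ := statEvent_eq_some.1 he
  by_cases hesc : ∃ l ∈ J, ∃ η < i, i ≤ F l η
  · obtain ⟨l, hl, η, hη, hFη⟩ := hesc
    refine ⟨l, hl, ?_⟩
    rw [statEvent_congr hℓ ((hF l hl).agreeBelow (hc.biUnion_inter ?_ hl) hη hFη), he]
    rintro a D ⟨-, F, hF⟩ ξ hξ
    exact hF.2 ξ (hF.1 ξ hξ)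
  · push Not at hesc
    have hb : ∀ η, η < i → ∃ b < i, ∀ l ≤ η, ∀ η' ≤ η, (if l ∈ J then F l η' else η) ≤ b :=
      fun η hη => hi.exists_bound₂ hη fun l hl η' hη' => by
        split_ifs with h
        exacts [hesc l h η' (hη'.trans_lt hη), hη]
    choose! f hfi hf using hb
    obtain ⟨δ, ⟨ξ, hξ, rfl⟩, hδi, hδ⟩ := hst f hfi
    refine absurd hδ (notMem_closurePts_of_diagonal hJ hc hF hξ fun η hη l hl hlη η' hη' => ?_)
    have := hf η (hη.trans hδi) l hlη η' hη'
    rwa [if_pos hl] at this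

namespace IsMinimalPair

variable [RegularIndex K] [WellFoundedLT K]

theorem limit_admissible {J : Set K} (hJ : IsLowerSet J) {a D : K → Set K}
    (hc : IsApproxChain (StatValid N g) (fun l => {ξ | g ξ ≤ l}) J a D) :
    ∃ F, ∀ ξ ∈ ⋃ l ∈ J, a l, g ξ ∉ closurePts F := by
  choose! F hF using fun l hl => (hc.valid l hl).2
  choose f hf using fun η => RegularIndex.exists_bound₂ η F
  exact ⟨f, fun ξ hξ => notMem_closurePts_of_diagonal hJ hc hF hξ
    fun η _ l _ hl η' hη' => hf η l hl η' hη'⟩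

theorem limit_statValid (H : IsMinimalPair N g) {k : K} {a D : K → Set K}
    (hc : IsApproxChain (StatValid N g) (fun l => {ξ | g ξ ≤ l}) (Set.Iio k) a D) :
    ∃ D', (∀ l < k, D l ⊆ D') ∧ StatValid N g (⋃ l < k, a l) D' := by
  choose! F hF using fun l hl => (hc.valid l hl).2
  choose f hf using fun η => RegularIndex.exists_lt_Iic k fun l => F l η
  refine ⟨(⋃ l < k, D l) ∪ {ξ | g ξ ∉ closurePts f}, fun l hl => ?_,
    H.null.union_mem (H.null.biUnion_Iio_mem k fun l hl => (hc.valid l hl).1)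
      (H.closurePts_mem f), f, fun ξ hξ => ?_, fun ξ hξ => Or.inr hξ⟩
  · exact fun ξ hξ => Or.inl (Set.mem_iUnion₂.2 ⟨l, hl, hξ⟩)
  · obtain ⟨l, hl, hξl⟩ := Set.mem_iUnion₂.1 hξ
    have hl : l < k := hl
    exact fun h => (hF l hl).1 ξ hξl (closurePts_anti (fun η => (hf η l hl.le).le) h)

/-- Reflection of the co-null set `S` of undecided points gives room for a stationary addition below
some `i`; the least such `i` ensures that no other event changes. -/
theorem exists_add (H : IsMinimalPair N g) (hℓ : IsInvariantLabel ℓ)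
    (hℓ' : ∀ i, IsRegPt i → ∀ R G, IsStatAt i R → Disjoint G R → ∀ j < i, ∀ ε,
      ∃ R' ⊆ R, IsStatAt i R' ∧ ℓ i (G ∪ R') = (j, ε))
    {a D : Set K} (h : StatValid N g a D) (k j : K) (ε : Bool) :
    ∃ a' D' i, StatValid N g a' D' ∧ D ⊆ D' ∧ a' ∩ D = a ∧ k < i ∧
      statEvent g ℓ a' i = some (j, ε) ∧ ∀ i' ≠ i, statEvent g ℓ a' i' = statEvent g ℓ a i' := by
  obtain ⟨hD, F, hF⟩ := h
  let S : Set K := {ξ | ξ ∉ D ∧ max k j < g ξ}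
  have hS : Sᶜ ∈ N := by
    refine H.null.mono (H.null.union_mem hD (H.unbounded (max k j))) fun ξ hξ => ?_
    by_contra hcon
    rw [Set.mem_union, not_or] at hcon
    exact hξ ⟨hcon.1, not_le.1 hcon.2⟩
  have hScl : ∀ ξ ∈ S, g ξ ∈ closurePts F := fun ξ hξ => by
    by_contra hcon
    exact hξ.1 (hF.2 ξ hcon)
  obtain ⟨i, ⟨hi, hst⟩, hmin⟩ := WellFounded.has_min (wellFounded_lt (α := K))
    {i | IsRegPt i ∧ IsStatAt i (g '' S)} (H.exists_isStatAt hS)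
  have : Nonempty K := ⟨i⟩
  obtain ⟨η₀, hη₀⟩ := hst.exists_lt
  have hkj : max k j < i := by
    obtain ⟨δ, ⟨ξ, hξ, rfl⟩, -, hδ⟩ := hst.exists_between hη₀
    exact hξ.2.trans hδ
  obtain ⟨R', hR'S, hR', hlab⟩ := hℓ' i hi (g '' S) (g '' a) hst (by
    refine Set.disjoint_left.2 ?_
    rintro _ ⟨ξ, hξ, rfl⟩ ⟨ξ', hξ', he⟩
    exact hF.1 ξ hξ (he ▸ hScl ξ' hξ')) j ((le_max_right _ _).trans_lt hkj) ε
  let r : Set K := {ξ ∈ S | g ξ ∈ R' ∧ g ξ < i}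
  have hag : AgreeBelow i (g '' a ∪ R') (g '' (a ∪ r)) := by
    refine ⟨η₀, hη₀, fun δ _ hδ => ?_⟩
    rw [Set.image_union]
    refine or_congr Iff.rfl ⟨fun h => ?_, ?_⟩
    · obtain ⟨ξ, hξ, rfl⟩ := hR'S h
      exact ⟨ξ, ⟨hξ, h, hδ⟩, rfl⟩
    · rintro ⟨ξ, hξ, rfl⟩
      exact hξ.2.1
  have hsub : closurePts (fun η => max (F η) i) ⊆ closurePts F :=
    closurePts_anti fun η => le_max_left _ _
  -- Taking the maximum with `i` pushes all closure points above `i`, beyond the values of `g` on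
  -- `r`, so the enlarged set still has a witness.
  refine ⟨a ∪ r, D ∪ {ξ | g ξ ∉ closurePts fun η => max (F η) i}, i,
    ⟨H.null.union_mem hD (H.closurePts_mem _), fun η => max (F η) i, ?_, fun ξ hξ => Or.inr hξ⟩,
    Set.subset_union_left, ?_, (le_max_left _ _).trans_lt hkj, ?_, fun i' hi' => ?_⟩
  · rintro ξ (hξ | hξ) hcl
    · exact hF.1 ξ hξ (hsub hcl)
    · obtain ⟨η, hη⟩ := hcl.1
      exact absurd ((le_max_right _ _).trans_lt (hcl.2 η hη)) (not_lt.2 hξ.2.2.le)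
  · ext ξ
    refine ⟨?_, fun h => ⟨Or.inl h, hF.2 ξ (hF.1 ξ h)⟩⟩
    rintro ⟨h | h, hξD⟩
    · exact h
    · exact absurd hξD h.1.1
  · refine statEvent_eq_some.2 ⟨hi, (hR'.mono fun _ h _ => Or.inr h).of_agreeBelow hag, ?_⟩
    rw [← hℓ i hi _ _ hag, hlab]
  · rcases lt_or_gt_of_ne hi' with hlt | hlt
    -- Where `a` already has a stationary trace, `F` escapes `i'` and the addition, consisting of
    -- closure points of `F`, is bounded below `i'`. Elsewhere a new stationary trace would
    -- contradict the minimality of `i`.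
    · by_cases hesc : IsStatAt i' (g '' a)
      · obtain ⟨η, hη, hFη⟩ := hesc.exists_escape (F := F) (by
          rintro _ ⟨ξ, hξ, rfl⟩
          exact hF.1 ξ hξ)
        refine statEvent_congr hℓ ⟨η, hη, fun δ h1 h2 => ?_⟩
        rw [Set.image_union]
        refine ⟨fun h => h.resolve_right ?_, Or.inl⟩
        rintro ⟨ξ, hξ, rfl⟩
        exact notMem_closurePts_of_escape hFη h1 h2 (hScl ξ hξ.1)
      · ext v
        simp only [statEvent_eq_some]
        refine and_congr_right fun hreg => iff_of_false (fun h => ?_) fun h => hesc h.1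
        have h := h.1
        rw [Set.image_union] at h
        rcases h.or_of_union with h | h
        · exact hesc h
        · refine hmin i' ⟨hreg, h.mono ?_⟩ hlt
          rintro _ ⟨ξ, hξ, rfl⟩ _
          exact ⟨ξ, hξ.1, rfl⟩
    · refine statEvent_congr hℓ ⟨i, hlt, fun δ h1 h2 => ?_⟩
      rw [Set.image_union]
      refine ⟨fun h => h.resolve_right ?_, Or.inl⟩
      rintro ⟨ξ, hξ, rfl⟩
      exact absurd hξ.2.2 (not_lt.2 h1.le)

theorem nonempty_eventSystem (H : IsMinimalPair N g) : Nonempty (EventSystem N) := by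
  have hlab : ∀ i : K, ∃ ℓ : Set K → K × Bool, IsRegPt i →
      (∀ X Y, AgreeBelow i X Y → ℓ X = ℓ Y) ∧
      ∀ R G, IsStatAt i R → Disjoint G R → ∀ j < i, ∀ ε,
        ∃ R' ⊆ R, IsStatAt i R' ∧ ℓ (G ∪ R') = (j, ε) := by
    intro i
    by_cases hi : IsRegPt i
    · obtain ⟨ℓ, h⟩ := exists_label i hi
      exact ⟨ℓ, fun _ => h⟩
    · exact ⟨fun _ => (i, true), fun h => absurd h hi⟩
  choose ℓ hℓ using hlab
  have hinv : IsInvariantLabel ℓ := fun i hi => (hℓ i hi).1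
  have hsub : ∀ {a D : Set K}, StatValid N g a D → a ⊆ D := by
    rintro a D ⟨-, F, hF⟩ ξ hξ
    exact hF.2 ξ (hF.1 ξ hξ)
  exact ⟨
  { ev := statEvent g ℓ
    valid := StatValid N g
    admissible := fun x => ∃ F, ∀ ξ ∈ x, g ξ ∉ closurePts F
    front := fun l => {ξ | g ξ ≤ l}
    ev_local := fun i => ⟨{ξ | g ξ ≤ i}, H.unbounded i, fun x y hxy =>
      statEvent_congr_of_forall hinv fun δ hδ => by
        have key : ∀ x y : Set K, x ∩ {ξ | g ξ ≤ i} = y ∩ {ξ | g ξ ≤ i} →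
            δ ∈ g '' x → δ ∈ g '' y := by
          rintro x y hxy ⟨ξ, hξ, rfl⟩
          have : ξ ∈ y ∩ {ξ | g ξ ≤ i} := hxy ▸ ⟨hξ, hδ.le⟩
          exact ⟨ξ, this.1, rfl⟩
        exact ⟨key x y hxy, key y x hxy.symm⟩⟩
    valid_mem := fun h => h.1
    valid_subset := hsub
    valid_mono := by
      rintro a D D' ⟨-, F, hF⟩ hD hD'
      exact ⟨hD', F, hF.1, fun ξ hξ => hD (hF.2 ξ hξ)⟩
    front_mem := H.unbounded
    persist := by
      rintro a D x i v ⟨-, F, hF⟩ hx he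
      obtain ⟨η, hη, hFη⟩ := (statEvent_eq_some.1 he).2.1.exists_escape (F := F) (by
        rintro _ ⟨ξ, hξ, rfl⟩
        exact hF.1 ξ hξ)
      rw [← statEvent_congr hinv (hF.agreeBelow hx hη hFη), he]
    restrict := by
      rintro x D ⟨F, hF⟩ hD
      have hx : x ∩ (D ∪ {ξ | g ξ ∉ closurePts F}) = x :=
        Set.inter_eq_left.2 fun ξ hξ => Or.inr (hF ξ hξ)
      refine ⟨D ∪ {ξ | g ξ ∉ closurePts F}, Set.subset_union_left, ?_, fun i v h => by rwa [hx] at h⟩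
      rw [hx]
      exact ⟨H.null.union_mem hD (H.closurePts_mem F), F, hF, fun ξ hξ => Or.inr hξ⟩
    limit_ev := fun hJ hc he => limit_statEvent hinv hJ hc he
    limit_admissible := fun hJ hc => limit_admissible hJ hc
    limit_valid := fun hc => H.limit_statValid hc
    add := fun h k j ε => H.exists_add hinv (fun i hi => (hℓ i hi).2) h k j ε }⟩

end IsMinimalPair

/-- Every null family has diagonal events. -/
theorem IsNullFamily.hasDiagonalEvents [RegularIndex K] [WellFoundedLT K] (hN : IsNullFamily N) :
    HasDiagonalEvents N := by
  by_cases hs : IsSaturated N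
  · obtain ⟨A, hA, g, hg, hm⟩ := exists_isMinimalMod hN hs
    obtain ⟨𝓔⟩ := IsMinimalPair.nonempty_eventSystem
      ⟨hN.restrictTo hA, hs.restrictTo hN A, hg, hm⟩
    exact hasDiagonalEvents_of_restrictTo hN hA 𝓔
  · simp only [IsSaturated] at hs
    push Not at hs
    obtain ⟨f, hf⟩ := hs
    have hcard : #K = #(K × Bool) := by
      have := (RegularIndex.aleph0_lt (K := K)).le
      rw [mk_prod, Cardinal.lift_uzero, mul_eq_left this]
      · exact (lift_le_aleph0.2 mk_le_aleph0).trans this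
      · simp
    obtain ⟨e⟩ := Cardinal.eq.1 hcard
    refine hasDiagonalEvents_of_restrictTo hN hN.univ_notMem (A := Set.univ)
      (EventSystem.ofFibres (hN.restrictTo hN.univ_notMem) (e ∘ f) fun v => ?_)
    have : (e ∘ f) ⁻¹' {v} = f ⁻¹' {e.symm v} := by
      ext ξ
      simp [Equiv.eq_symm_apply]
    rw [this, IdealBorel.restrictTo, Set.mem_ofPred_eq, Set.inter_univ]
    exact hf _

end

/-! ### Transfer to the spaces of functions -/

section

variable {κ : Cardinal.{u}}

theorem regularIndex_ord (hreg : κ.IsRegular) (hunc : ℵ₀ < κ) : RegularIndex κ.ord.ToType where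
  aleph0_lt := by rwa [mk_ord_toType]
  mk_Iic_lt k := by
    have := Cardinal.noMaxOrder hreg.aleph0_le
    obtain ⟨b, hb⟩ := exists_gt k
    exact (mk_le_mk_of_subset (Set.Iic_subset_Iio.2 hb)).trans_lt
      (mk_Iio_lt b (by rw [mk_ord_toType, type_toType]))
  exists_lt {ι} hι f := by
    rw [mk_ord_toType] at hι
    have hl : Order.IsSuccLimit κ.ord := isSuccLimit_ord hreg.aleph0_le
    have hb : (⨆ i, Order.succ (ToType.mk.symm (f i)).1) < κ.ord :=
      Ordinal.iSup_lt_of_lt_cof (by rwa [hreg.cof_ord]) fun i =>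
        hl.succ_lt (ToType.mk.symm (f i)).2
    refine ⟨ToType.mk ⟨_, hb⟩, fun i => ?_⟩
    rw [← OrderIso.symm_apply_lt]
    have := Ordinal.le_iSup (fun i => Order.succ (ToType.mk.symm (f i)).1) i
    exact Subtype.coe_lt_coe.1 (Order.succ_le_iff.1 this)

theorem isNullFamily_ideal {I : Order.Ideal (Set κ.ord.ToType)} (hproper : I.IsProper)
    (hcomplete : IsComplete κ I) (hbdd : ExtendsBounded I) :
    IsNullFamily {D | D ∈ I} where
  mono h h' := I.lower h' h
  iUnion_mem {ι} hι {D} hD := by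
    rw [mk_ord_toType] at hι
    rw [← Set.sUnion_range]
    exact hcomplete _ (Set.forall_mem_range.2 hD) (mk_range_le.trans_lt hι)
  univ_notMem h := hproper.ne_univ (Set.eq_univ_of_forall fun D => I.lower (Set.subset_univ D) h)
  Iic_mem k := hbdd _ bddAbove_Iic

theorem exists_agree_subset {K : Type u} {ν : Type v} {I : Order.Ideal (Set K)} {U : Set (K → ν)}
    (hU : IsOpen[idealTopology I ν] U) {x : K → ν} (hx : x ∈ U) :
    ∃ D ∈ I, ∀ y : K → ν, (∀ i ∈ D, y i = x i) → y ∈ U := by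
  induction hU generalizing x with
  | basic s hs =>
    obtain ⟨D, hD, f, rfl⟩ := hs
    exact ⟨D, hD, fun y hy i => (hy i i.2).trans (hx i)⟩
  | univ =>
    obtain ⟨D, hD⟩ := I.nonempty
    exact ⟨D, hD, fun _ _ => trivial⟩
  | inter s t _ _ ihs iht =>
    obtain ⟨D, hD, h⟩ := ihs hx.1
    obtain ⟨D', hD', h'⟩ := iht hx.2
    exact ⟨D ⊔ D', Order.Ideal.sup_mem hD hD', fun y hy =>
      ⟨h y fun i hi => hy i (Or.inl hi), h' y fun i hi => hy i (Or.inr hi)⟩⟩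
  | sUnion S _ ih =>
    obtain ⟨s, hs, hxs⟩ := hx
    obtain ⟨D, hD, h⟩ := ih s hs hxs
    exact ⟨D, hD, fun y hy => ⟨s, hs, h y hy⟩⟩

theorem isOpen_of_agree_subset {K : Type u} {ν : Type v} {I : Order.Ideal (Set K)}
    {U : Set (K → ν)}
    (h : ∀ x ∈ U, ∃ D ∈ I, ∀ y : K → ν, (∀ i ∈ D, y i = x i) → y ∈ U) :
    IsOpen[idealTopology I ν] U := by
  let _ := idealTopology I ν
  refine isOpen_iff_forall_mem_open.2 fun x hx => ?_
  obtain ⟨D, hD, h⟩ := h x hx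
  exact ⟨cone fun i : D => x i, fun y hy => h y fun i hi => hy ⟨i, hi⟩,
    TopologicalSpace.isOpen_generateFrom_of_mem ⟨D, hD, _, rfl⟩, fun _ => rfl⟩

open Classical in
/-- The two-valued function with support `A`. -/
noncomputable def twoValued {K : Type u} {ν : Type v} (p q : ν) (A : Set K) : K → ν :=
  fun i => if i ∈ A then p else q

theorem setOf_twoValued_eq {K : Type u} {ν : Type v} {p q : ν} (hpq : p ≠ q) (A : Set K) :
    {i | twoValued p q A i = p} = A := by
  classical
  ext i
  by_cases hi : i ∈ A <;> simp [twoValued, hi, hpq.symm]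

theorem isTraceOpen_twoValued {K : Type u} [LinearOrder K] {ν : Type v}
    {I : Order.Ideal (Set K)} {U : Set (K → ν)} (hU : IsOpen[idealTopology I ν] U) (p q : ν) :
    IsTraceOpen {D | D ∈ I} {A | twoValued p q A ∈ U} := fun A hA => by
  classical
  obtain ⟨D, hD, h⟩ := exists_agree_subset hU hA
  refine ⟨D, hD, fun A' hA' => h _ fun i hi => ?_⟩
  have : i ∈ A' ↔ i ∈ A := by simpa [hi] using Set.ext_iff.1 hA' i
  simp [twoValued, this]

theorem isOpen_setOf_support {K : Type u} {ν : Type v} {I : Order.Ideal (Set K)} (p : ν)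
    {B : Set K} (hB : B ∈ I) {C : Set K → Prop} (hC : ∀ x y, x ∩ B = y ∩ B → C x → C y) :
    IsOpen[idealTopology I ν] {x : K → ν | C {i | x i = p}} :=
  isOpen_of_agree_subset fun x hx => ⟨B, hB, fun y hy => hC _ _ (by
    ext i
    simp only [Set.mem_inter_iff, Set.mem_ofPred_eq]
    exact and_congr_left fun hi => by rw [hy i hi]) hx⟩

/-- The hierarchy of a topology does not collapse if sets can be encoded by points in such a way
that open sets become open sets of traces and local properties of sets become open. -/
theorem not_collapses_of_encoding (hκ : ℵ₀ ≤ κ) {X : Type u} {τ : TopologicalSpace X}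
    {N : Set (Set κ.ord.ToType)} [RegularIndex κ.ord.ToType] (hN : IsNullFamily N)
    (supp : X → Set κ.ord.ToType) (ind : Set κ.ord.ToType → X) (hsi : ∀ A, supp (ind A) = A)
    (hind : ∀ U, IsOpen[τ] U → IsTraceOpen N {A | ind A ∈ U})
    (hsupp : ∀ B ∈ N, ∀ C : Set κ.ord.ToType → Prop, (∀ x y, x ∩ B = y ∩ B → C x → C y) →
      IsOpen[τ] {x | C (supp x)}) : ¬ Collapses κ τ := by
  obtain ⟨ev, hloc, hdiag⟩ := hN.hasDiagonalEvents
  refine not_collapses_of_diagonal hκ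
    (fun j => {x | ∃ i, ev (supp x) i = some (j, true) ∧
      ∀ i' > i, ∀ ε, ev (supp x) i' ≠ some (j, ε)}) (fun j => ?_) fun U hU => ?_
  -- For fixed `i` and `i'` the condition depends on a null trace only, so it is open; the set for
  -- `j` is a κ-union of κ-intersections of such sets.
  · have hopen : ∀ i i', {x | ev (supp x) i = some (j, true) ∧
        (i' > i → ∀ ε, ev (supp x) i' ≠ some (j, ε))} ∈ borelClass κ τ := by
      intro i i'
      obtain ⟨B, hB, h⟩ := hloc i
      obtain ⟨B', hB', h'⟩ := hloc i'
      refine mem_borelClass_of_isOpen (hsupp (B ∪ B') (hN.union_mem hB hB')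
        (fun A => ev A i = some (j, true) ∧ (i' > i → ∀ ε, ev A i' ≠ some (j, ε)))
        fun x y hxy hx => ?_)
      have key : ∀ E ⊆ B ∪ B', x ∩ E = y ∩ E := fun E hE => by
        rw [← Set.inter_eq_right.2 hE, ← Set.inter_assoc, hxy, Set.inter_assoc]
      rwa [← h x y (key B Set.subset_union_left), ← h' x y (key B' Set.subset_union_right)]
    have := (isSuccAlgebra_borelClass (τ := τ) (κ := κ)).iUnion_mem mk_index_le fun i =>
      isSuccAlgebra_borelClass.iInter_mem mk_index_le (hopen i)
    convert this using 1
    have := nonempty_index hκ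
    ext x
    simp only [Set.mem_ofPred_eq, Set.mem_iUnion, Set.mem_iInter, forall_and, forall_const]
  · obtain ⟨A, hA⟩ := hdiag (fun k => {A | ind A ∈ U k}) fun k => hind _ (hU k)
    refine ⟨ind A, fun j => (hA j).trans ?_⟩
    simp only [Set.mem_ofPred_eq, hsi]

end

end IdealBorel

theorem mainTheorem1 (κ : Cardinal.{u}) (hreg : κ.IsRegular) (hunc : ℵ₀ < κ)
    (I : Order.Ideal (Set κ.ord.ToType)) (hproper : I.IsProper)
    (hcomplete : IdealBorel.IsComplete κ I) (hbdd : IdealBorel.ExtendsBounded I) :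
    (¬ IdealBorel.Collapses κ (IdealBorel.idealTopology I (Fin 2)) ∧
      IdealBorel.HasFullLength κ (IdealBorel.idealTopology I (Fin 2))) ∧
    (¬ IdealBorel.Collapses κ (IdealBorel.idealTopology I κ.ord.ToType) ∧
      IdealBorel.HasFullLength κ (IdealBorel.idealTopology I κ.ord.ToType)) := by
  have := IdealBorel.regularIndex_ord hreg hunc
  have hN := IdealBorel.isNullFamily_ideal hproper hcomplete hbdd
  have h₂ : ¬ IdealBorel.Collapses κ (IdealBorel.idealTopology I (Fin 2)) :=
    IdealBorel.not_collapses_of_encoding hunc.le hN (fun x => {i | x i = 1})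
      (IdealBorel.twoValued 1 0) (IdealBorel.setOf_twoValued_eq one_ne_zero)
      (fun U hU => IdealBorel.isTraceOpen_twoValued hU 1 0)
      fun B hB C hC => IdealBorel.isOpen_setOf_support 1 hB hC
  have hκ : ¬ IdealBorel.Collapses κ (IdealBorel.idealTopology I κ.ord.ToType) := by
    obtain ⟨q⟩ := IdealBorel.nonempty_index hunc.le
    obtain ⟨p, hpq⟩ := IdealBorel.RegularIndex.exists_gt q
    exact IdealBorel.not_collapses_of_encoding hunc.le hN (fun x => {i | x i = p})
      (IdealBorel.twoValued p q) (IdealBorel.setOf_twoValued_eq hpq.ne')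
      (fun U hU => IdealBorel.isTraceOpen_twoValued hU p q)
      fun B hB C hC => IdealBorel.isOpen_setOf_support p hB hC
  exact ⟨⟨h₂, IdealBorel.hasFullLength_of_not_collapses hunc.le h₂⟩,
    hκ, IdealBorel.hasFullLength_of_not_collapses hunc.le hκ⟩
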